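/- Let $\mathcal H$ be a separable complex Hilbert space with identity $I$, and for $p\in\mathbb N$ let $\mathcal B_p(\mathcal H)$ be the $\ell^p$-based Schatten--von Neumann class. For an orthonormal basis $(h_i)$ of $\mathcal H$ and $T\in\mathcal B_1(\mathcal H)$ let $\operatorname{tr}(T)=\sum_i (h_i,Th_i)$, and let $\det(I+T)$ be the Fredholm determinant, i.e. the limit of the determinants of the finite sections $(\delta_{ij}+(h_i,Th_j))$ (neither depends on the basis). For $T\in\mathcal B_p(\mathcal H)$ put $$\textstyle\det_p(I+T)=\det(I+R_p(T)),\qquad R_p(T)=(I+T)\exp\Big(\sum_{j=1}^{p-1}\frac{(-1)^j}{j}T^j\Big)-I .$$ Let $k\in\mathbb N$, $k\ge 1$. In the algebra of polynomials with rational coefficients in two noncommuting variables $A,B$ put $$X_k(A,B)=\sum_{j=1}^{k-1}\frac1j\sum_{\substack{S\subseteq\{1,\dots,j\}\\ j+|S|\ge k}}(-1)^{|S|}\,y_{1,S}\,y_{2,S}\cdots y_{j,S},\qquad y_{m,S}=\begin{cases}AB,& m\in S,\\ A+B,& m\notin S.\end{cases}$$ Then $X_1=0$, and for $k\ge2$ there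 are $C_1,\dots,C_{2k-2}\in\{A,B\}$ and rational numbers $c_{j_1,\dots,j_{2k-2}}$, vanishing unless $k\le j_1+\dots+j_{2k-2}\le 2k-2$, such that $$X_k(A,B)=\sum_{j_1,\dots,j_{2k-2}=0}^{k-1}c_{j_1,\dots,j_{2k-2}}\,C_1^{j_1}\cdots C_{2k-2}^{j_{2k-2}} .$$ Moreover, for all operators $A,B\in\mathcal B_k(\mathcal H)$ one has $X_k(A,B)\in\mathcal B_1(\mathcal H)$ and $(I-A)(I-B)-I\in\mathcal B_k(\mathcal H)$; the trace of $X_k(A,B)$ and the determinants below exist and do not depend on the orthonormal basis used to compute them; and $$\textstyle\det_k\big((I-A)(I-B)\big)=\det_k(I-A)\,\det_k(I-B)\,\exp\big(\operatorname{tr}X_k(A,B)\big).$$ -/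

import Mathlib

open Filter Topology

universe u

noncomputable section

/-! ### The noncommutative polynomials `X_k` -/

/-- The algebra of polynomials with rational coefficients in two noncommuting variables. -/
abbrev Pol₂ : Type := FreeAlgebra ℚ Bool

/-- The variable `A`. -/
def varA : Pol₂ := FreeAlgebra.ι ℚ false

/-- The variable `B`. -/
def varB : Pol₂ := FreeAlgebra.ι ℚ true

/-- For `S ⊆ {1, …, j}`, the ordered product `y_1 ⋯ y_j` in which `y_m = AB` if `m ∈ S` and
`y_m = A + B` if `m ∉ S`. -/
def yWord (j : ℕ) (S : Finset (Fin j)) : Pol₂ :=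
  (List.ofFn fun m : Fin j => if m ∈ S then varA * varB else varA + varB).prod

/-- The polynomial
`X_k = ∑_{j = 1}^{k - 1} j⁻¹ ∑_{S ⊆ {1, …, j}, j + |S| ≥ k} (-1)^{|S|} y_S`; in particular
`X_1 = 0`. -/
def polX (k : ℕ) : Pol₂ :=
  ∑ j ∈ Finset.Icc 1 (k - 1), (j : ℚ)⁻¹ •
    ∑ S ∈ (Finset.univ : Finset (Finset (Fin j))) with k ≤ j + S.card,
      ((-1 : ℚ) ^ S.card) • yWord j S

section Operators

variable {H : Type u} [NormedAddCommGroup H] [InnerProductSpace ℂ H]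

/-- The bounded operator `p(A, B)` obtained by substituting the operators `A`, `B` for the
variables of the noncommutative polynomial `p`. -/
def evalPol (A B : H →L[ℂ] H) (p : Pol₂) : H →L[ℂ] H :=
  letI : Algebra ℚ (H →L[ℂ] H) := Algebra.compHom (H →L[ℂ] H) (algebraMap ℚ ℂ)
  FreeAlgebra.lift ℚ (fun b : Bool => if b then B else A) p

/-! ### Schatten–von Neumann classes -/

/-- The singular numbers `s_0(T) ≥ s_1(T) ≥ …` of a bounded Hilbert space operator: `s_n(T)` is
the operator norm distance from `T` to the operators of rank at most `n`.  For compact `T` these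
are the eigenvalues of `|T|`, in decreasing order and repeated by multiplicity; see
`singularNumber_eq_of_schmidt`. -/
def singularNumber (T : H →L[ℂ] H) (n : ℕ) : ℝ :=
  ⨅ F : {F : H →L[ℂ] H // (F : H →ₗ[ℂ] H).rank ≤ (n : Cardinal.{u})}, ‖T - F.1‖

/-- `T ∈ B_p(H)`, i.e. the singular numbers of `T` form a sequence in `ℓ^p`.  (If this holds,
then `T` is a norm limit of operators of finite rank, hence compact.) -/
def IsSchatten (p : ℕ) (T : H →L[ℂ] H) : Prop :=
  Summable fun n : ℕ => singularNumber T n ^ p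

/-! ### Trace -/

/-- `T` has the trace `t`: for every orthonormal basis `(b_i)` of `H` the sum
`∑_i ⟪b_i, T b_i⟫` converges (unconditionally) to `t`. -/
def HasTrace (T : H →L[ℂ] H) (t : ℂ) : Prop :=
  ∀ (ι : Type u) (b : HilbertBasis ι ℂ H), HasSum (fun i => inner ℂ (b i) (T (b i))) t

open Classical in
/-- The trace of `T` (with value `0` if `T` has no trace in the sense of `HasTrace`). -/
def opTrace (T : H →L[ℂ] H) : ℂ :=
  if h : ∃ t, HasTrace T t then h.choose else 0

/-! ### Fredholm determinants -/

open Classical in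
/-- The determinant of the finite section `(δ_{ij} + ⟪b_i, T b_j⟫)_{i, j ∈ s}`. -/
def sectionDet {ι : Type u} (b : HilbertBasis ι ℂ H) (T : H →L[ℂ] H) (s : Finset ι) : ℂ :=
  Matrix.det (1 + Matrix.of fun i j : s => inner ℂ (b i) (T (b j)))

/-- `I + T` has the Fredholm determinant `d`: for every orthonormal basis of `H` the
determinants of the finite sections of `I + T` converge to `d`. -/
def HasFredholmDet (T : H →L[ℂ] H) (d : ℂ) : Prop :=
  ∀ (ι : Type u) (b : HilbertBasis ι ℂ H), Tendsto (sectionDet b T) atTop (𝓝 d)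

/-- `R_p(T) = (I + T) exp (∑_{j = 1}^{p - 1} (-1)^j j⁻¹ T^j) - I`; in particular `R_1(T) = T`. -/
def regR (p : ℕ) (T : H →L[ℂ] H) : H →L[ℂ] H :=
  (1 + T) * NormedSpace.exp (∑ j ∈ Finset.Icc 1 (p - 1), ((-1 : ℂ) ^ j * (j : ℂ)⁻¹) • T ^ j) - 1

/-- The operator `S = I + T`, `T ∈ B_p(H)`, has the `p`-th regularized Fredholm determinant `d`,
i.e. `T` is in `B_p(H)` and `I + R_p(T)` has the Fredholm determinant `d`. -/
def HasRegDet (p : ℕ) (S : H →L[ℂ] H) (d : ℂ) : Prop :=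
  IsSchatten p (S - 1) ∧ HasFredholmDet (regR p (S - 1)) d

open Classical in
/-- The `p`-th regularized Fredholm determinant `det_p(S)` (with value `0` if it does not exist
in the sense of `HasRegDet`); for `p = 1` it is the Fredholm determinant. -/
def regDet (p : ℕ) (S : H →L[ℂ] H) : ℂ :=
  if h : ∃ d, HasRegDet p S d then h.choose else 0

/-- Consistency of `singularNumber` with the singular value (Schmidt) decomposition: if
`T = ∑ s_n ⟪e_n, ·⟫ f_n` with orthonormal sequences `(e_n)`, `(f_n)` and numbers
`s_0 ≥ s_1 ≥ … ≥ 0`, then `s_n(T) = s_n`. -/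
theorem singularNumber_eq_of_schmidt {e f : ℕ → H} (he : Orthonormal ℂ e)
    (hf : Orthonormal ℂ f) {s : ℕ → ℝ} (hs : Antitone s) (hs0 : ∀ n, 0 ≤ s n)
    {T : H →L[ℂ] H}
    (hT : ∀ x, HasSum (fun m => ((s m : ℂ) * inner ℂ (e m) x) • f m) (T x)) (n : ℕ) :
    singularNumber T n = s n := by
  classical
  have hbdd : BddBelow (Set.range fun F : {F : H →L[ℂ] H //
      (F : H →ₗ[ℂ] H).rank ≤ (n : Cardinal.{u})} => ‖T - F.1‖) :=
    ⟨0, by rintro _ ⟨F, rfl⟩; exact norm_nonneg _⟩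
  have hnf : ∀ (t : Finset ℕ) (c : ℕ → ℂ), ‖∑ m ∈ t, c m • f m‖ ^ 2 = ∑ m ∈ t, ‖c m‖ ^ 2 := by
    intro t c
    have h := hf.inner_sum c c t
    rw [inner_self_eq_norm_sq_to_K] at h
    have h2 : ((‖∑ m ∈ t, c m • f m‖ ^ 2 : ℝ) : ℂ) = ((∑ m ∈ t, ‖c m‖ ^ 2 : ℝ) : ℂ) := by
      push_cast
      rw [← Complex.coe_algebraMap, h]
      exact Finset.sum_congr rfl fun m _ => by rw [Complex.conj_mul']; rfl
    exact_mod_cast h2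
  apply le_antisymm
  · let F : H →L[ℂ] H := ∑ m ∈ Finset.range n, (s m : ℂ) • (innerSL ℂ (e m)).smulRight (f m)
    have hFx : ∀ x, F x = ∑ m ∈ Finset.range n, ((s m : ℂ) * inner ℂ (e m) x) • f m := by
      intro x
      simp only [F, _root_.sum_apply, _root_.smul_apply,
        ContinuousLinearMap.smulRight_apply, innerSL_apply_apply, smul_smul]
    have hF : (F : H →ₗ[ℂ] H).rank ≤ (n : Cardinal.{u}) := by
      have hr : LinearMap.range (F : H →ₗ[ℂ] H) ≤
          Submodule.span ℂ (((Finset.range n).image f : Finset H) : Set H) := by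
        rintro _ ⟨x, rfl⟩
        rw [ContinuousLinearMap.coe_coe, hFx]
        refine Submodule.sum_mem _ fun m hm => Submodule.smul_mem _ _ (Submodule.subset_span ?_)
        exact_mod_cast Finset.mem_image_of_mem f hm
      refine (Submodule.rank_mono hr).trans ((rank_span_finset_le _).trans ?_)
      exact_mod_cast Finset.card_image_le.trans (Finset.card_range n).le
    refine (ciInf_le hbdd ⟨F, hF⟩).trans ?_
    refine ContinuousLinearMap.opNorm_le_bound _ (hs0 n) fun x => ?_
    have hlim : Tendsto (fun N => ‖(∑ m ∈ Finset.range N, ((s m : ℂ) * inner ℂ (e m) x) • f m)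
        - F x‖) atTop (𝓝 ‖(T - F) x‖) :=
      (((hT x).tendsto_sum_nat).sub_const (F x)).norm
    refine le_of_tendsto hlim (eventually_atTop.2 ⟨n, fun N hN => ?_⟩)
    rw [hFx, ← Finset.sum_sdiff (Finset.range_mono hN), add_sub_cancel_right]
    refine le_of_sq_le_sq ?_ (mul_nonneg (hs0 n) (norm_nonneg x))
    rw [hnf, mul_pow]
    calc _ ≤ ∑ m ∈ Finset.range N \ Finset.range n, s n ^ 2 * ‖inner ℂ (e m) x‖ ^ 2 := by
          refine Finset.sum_le_sum fun m hm => ?_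
          have hm' : n ≤ m := by simpa using (Finset.mem_sdiff.1 hm).2
          rw [norm_mul, mul_pow, Complex.norm_real, Real.norm_of_nonneg (hs0 m)]
          have := hs0 m
          have := hs hm'
          gcongr
      _ = s n ^ 2 * ∑ m ∈ Finset.range N \ Finset.range n, ‖inner ℂ (e m) x‖ ^ 2 :=
          (Finset.mul_sum ..).symm
      _ ≤ _ := by
          gcongr
          exact he.sum_inner_products_le x
  · have : Nonempty {F : H →L[ℂ] H // (F : H →ₗ[ℂ] H).rank ≤ (n : Cardinal.{u})} :=
      ⟨⟨0, by simp⟩⟩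
    refine le_ciInf fun ⟨F, hF⟩ => ?_
    let V : (Fin (n + 1) → ℂ) →ₗ[ℂ] H := Fintype.linearCombination ℂ fun i => e i
    let G := ((F : H →ₗ[ℂ] H).rangeRestrict).comp V
    have : FiniteDimensional ℂ (LinearMap.range (F : H →ₗ[ℂ] H)) :=
      Module.rank_lt_aleph0_iff.1 (hF.trans_lt (Cardinal.natCast_lt_aleph0))
    have hdim : Module.finrank ℂ (LinearMap.range (F : H →ₗ[ℂ] H)) ≤ n :=
      Module.finrank_le_of_rank_le hF
    have hker : LinearMap.ker G ≠ ⊥ :=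
      LinearMap.ker_ne_bot_of_finrank_lt (by simpa using Nat.lt_succ_of_le hdim)
    obtain ⟨c, hc, hc0⟩ := Submodule.exists_mem_ne_zero_of_ne_bot hker
    have hFx : F (V c) = 0 := congrArg Subtype.val (LinearMap.mem_ker.1 hc)
    let c' : ℕ → ℂ := fun m => if h : m < n + 1 then c ⟨m, h⟩ else 0
    have hV : V c = ∑ m ∈ Finset.range (n + 1), c' m • e m := by
      rw [Finset.sum_range]
      simp only [V, c', Fintype.linearCombination_apply, Fin.is_lt, dite_true, Fin.eta]
    have hin : ∀ m, inner ℂ (e m) (V c) = c' m := by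
      intro m
      rw [hV]
      by_cases hm : m ∈ Finset.range (n + 1)
      · exact he.inner_right_sum c' hm
      · have h0 : c' m = 0 := dif_neg (by simpa using hm)
        rw [h0, inner_sum]
        refine Finset.sum_eq_zero fun i hi => ?_
        rw [inner_smul_right, he.2 (by rintro rfl; exact hm hi), mul_zero]
    have hTx : T (V c) = ∑ m ∈ Finset.range (n + 1), ((s m : ℂ) * c' m) • f m := by
      refine (hT (V c)).unique ?_
      simp only [hin]
      refine hasSum_sum_of_ne_finset_zero fun m hm => ?_
      have h0 : c' m = 0 := dif_neg (by simpa using hm)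
      simp [h0]
    have hnV : ‖V c‖ ^ 2 = ∑ m ∈ Finset.range (n + 1), ‖c' m‖ ^ 2 := by
      have h := he.inner_sum c' c' (Finset.range (n + 1))
      rw [← hV, inner_self_eq_norm_sq_to_K] at h
      have h2 : ((‖V c‖ ^ 2 : ℝ) : ℂ) = ((∑ m ∈ Finset.range (n + 1), ‖c' m‖ ^ 2 : ℝ) : ℂ) := by
        push_cast
        rw [← Complex.coe_algebraMap, h]
        exact Finset.sum_congr rfl fun m _ => by rw [Complex.conj_mul']; rfl
      exact_mod_cast h2
    have hpos : 0 < ‖V c‖ := by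
      rw [norm_pos_iff]
      intro h0
      apply hc0
      funext i
      have := hin i
      rw [h0, inner_zero_right] at this
      simpa only [c', Fin.is_lt, dite_true, Fin.eta, Pi.zero_apply] using this.symm
    have hle : s n * ‖V c‖ ≤ ‖T - F‖ * ‖V c‖ := by
      have h1 : ‖T (V c)‖ ≤ ‖T - F‖ * ‖V c‖ := by
        have := (T - F).le_opNorm (V c)
        simpa [hFx] using this
      refine le_trans ?_ h1
      refine le_of_sq_le_sq ?_ (norm_nonneg _)
      rw [hTx, hnf, mul_pow, hnV, Finset.mul_sum]
      refine Finset.sum_le_sum fun m hm => ?_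
      have hm' : m ≤ n := by
        have := Finset.mem_range.1 hm
        omega
      rw [norm_mul, mul_pow, Complex.norm_real, Real.norm_of_nonneg (hs0 m)]
      have := hs0 n
      have := hs hm'
      gcongr
    exact le_of_mul_le_mul_right hle hpos

end Operators

end

/-! For matrices, `det_k(I - T) = det(I - T) exp(∑_{1 ≤ j < k} tr(T^j) / j)`. With `C = A + B - AB`
one has `I - C = (I - A)(I - B)`, so ordinary determinants multiply and the theorem becomes a trace
identity: the sum `∑ tr(C^j) / j` exceeds the sum of the corresponding expressions for `A` and `B`
by `tr X_k`. To prove it, put `u = X(A + B) - X²AB` with a central variable `X`, so that `1 - u = (1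
- XA)(1 - XB)`. In `u^j` the term of the set `S` has degree `j + |S|`. Cutting `-log(1 - u) = ∑ u^j
/ j` after `j = k - 1` leaves degrees below `k` intact, and under a trace the logarithm of the
product is additive, so the part of degree `0 < d < k` has trace `(tr A^d + tr B^d) / d`. The parts
of degree at least `k`, taken at `X = 1`, add up to `X_k`. This is `sum_inv_mul_trace_pow`.

For operators, compress to `PAP` and `PBP`, where `P` projects onto the span of finitely many basis
vectors; the matrix identity then holds exactly (`sectionDet_regR_product`). As `P` grows, `PAP → A`
in `B_k` (`schattenTendsto_basisProj_mul_mul`). Both `R_k` and `X_k` are continuous from `B_k` to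
`B_1`, by Hölder's inequality: `R_k(T) = T^k G(T)` with `G` norm continuous
(`one_add_mul_exp_sub_one_eq`), and every monomial of `X_k` has degree at least `k`. Finally, traces
and determinants of finite sections are controlled by the `B_1` size uniformly in the section
(`sum_norm_inner_apply_le`, `sectionDet_sub_norm_le`). Hence the limits exist, agree for all bases,
and may be taken while the operator varies with the section.

Schatten classes enter only through approximation numbers, with inequalities up to constants; this
suffices because only finiteness and convergence matter. The normal form of `X_k` comes from
counting letters in the words of its expansion. -/

open scoped ENNReal

/-! ### Inequalities for approximation numbers. -/

section SingularNumbers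

variable {H : Type u} [NormedAddCommGroup H] [InnerProductSpace ℂ H]

theorem singularNumber_nonneg (T : H →L[ℂ] H) (n : ℕ) : 0 ≤ singularNumber T n :=
  Real.iInf_nonneg fun _ => norm_nonneg _

theorem singularNumber_le {T F : H →L[ℂ] H} {n : ℕ}
    (hF : (F : H →ₗ[ℂ] H).rank ≤ (n : Cardinal.{u})) : singularNumber T n ≤ ‖T - F‖ :=
  ciInf_le (f := fun F : {F : H →L[ℂ] H // (F : H →ₗ[ℂ] H).rank ≤ (n : Cardinal.{u})} =>
    ‖T - F.1‖) ⟨0, by rintro _ ⟨F, rfl⟩; exact norm_nonneg _⟩ ⟨F, hF⟩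

theorem exists_norm_sub_lt_singularNumber_add (T : H →L[ℂ] H) (n : ℕ) {ε : ℝ} (hε : 0 < ε) :
    ∃ F : H →L[ℂ] H, (F : H →ₗ[ℂ] H).rank ≤ (n : Cardinal.{u}) ∧
      ‖T - F‖ < singularNumber T n + ε := by
  have : Nonempty {F : H →L[ℂ] H // (F : H →ₗ[ℂ] H).rank ≤ (n : Cardinal.{u})} :=
    ⟨⟨0, by simp⟩⟩
  obtain ⟨F, hF⟩ := exists_lt_of_ciInf_lt (lt_add_of_pos_right (singularNumber T n) hε)
  exact ⟨F.1, F.2, hF⟩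

theorem singularNumber_le_norm (T : H →L[ℂ] H) (n : ℕ) : singularNumber T n ≤ ‖T‖ := by
  simpa using singularNumber_le (T := T) (F := 0) (n := n) (by simp)

theorem singularNumber_zero_right (T : H →L[ℂ] H) : singularNumber T 0 = ‖T‖ := by
  refine le_antisymm (singularNumber_le_norm T 0) (le_of_forall_pos_le_add fun ε hε => ?_)
  obtain ⟨F, hF, h⟩ := exists_norm_sub_lt_singularNumber_add T 0 hε
  have hF0 : F = 0 := by
    have h0 : (F : H →ₗ[ℂ] H).rank = 0 := by simpa using hF
    have : (F : H →ₗ[ℂ] H) = 0 := by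
      rwa [LinearMap.rank, Submodule.rank_eq_zero, LinearMap.range_eq_bot] at h0
    ext x; exact LinearMap.congr_fun this x
  subst hF0
  simpa using h.le

theorem singularNumber_eq_zero_of_rank_le {F : H →L[ℂ] H} {n : ℕ}
    (hF : (F : H →ₗ[ℂ] H).rank ≤ (n : Cardinal.{u})) : singularNumber F n = 0 :=
  le_antisymm (by simpa using singularNumber_le (T := F) hF) (singularNumber_nonneg F n)

theorem singularNumber_antitone (T : H →L[ℂ] H) : Antitone (singularNumber T) := by
  intro m n hmn
  refine le_of_forall_pos_le_add fun ε hε => ?_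
  obtain ⟨F, hF, h⟩ := exists_norm_sub_lt_singularNumber_add T m hε
  exact (singularNumber_le (hF.trans (by exact_mod_cast hmn))).trans h.le

theorem singularNumber_add_le (S T : H →L[ℂ] H) (m n : ℕ) :
    singularNumber (S + T) (m + n) ≤ singularNumber S m + singularNumber T n := by
  refine le_of_forall_pos_le_add fun ε hε => ?_
  obtain ⟨F, hF, h⟩ := exists_norm_sub_lt_singularNumber_add S m (half_pos hε)
  obtain ⟨G, hG, h'⟩ := exists_norm_sub_lt_singularNumber_add T n (half_pos hε)
  have hr : ((F + G : H →L[ℂ] H) : H →ₗ[ℂ] H).rank ≤ ((m + n : ℕ) : Cardinal.{u}) := by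
    rw [ContinuousLinearMap.toLinearMap_add, Nat.cast_add]
    exact (LinearMap.rank_add_le _ _).trans (add_le_add hF hG)
  calc _ ≤ ‖S + T - (F + G)‖ := singularNumber_le hr
    _ = ‖(S - F) + (T - G)‖ := by congr 1; abel
    _ ≤ _ := (norm_add_le _ _).trans (by linarith)

/-- `ST - (F(T - G) + SG) = (S - F)(T - G)`, and the subtracted operator has rank at most `m + n`.
The infima need not be attained, hence the limit `ε → 0`. -/
theorem singularNumber_mul_le (S T : H →L[ℂ] H) (m n : ℕ) :
    singularNumber (S * T) (m + n) ≤ singularNumber S m * singularNumber T n := by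
  have key : ∀ ε : ℝ, 0 < ε → singularNumber (S * T) (m + n) ≤
      (singularNumber S m + ε) * (singularNumber T n + ε) := by
    intro ε hε
    obtain ⟨F, hF, h⟩ := exists_norm_sub_lt_singularNumber_add S m hε
    obtain ⟨G, hG, h'⟩ := exists_norm_sub_lt_singularNumber_add T n hε
    have hr : ((F * (T - G) + S * G : H →L[ℂ] H) : H →ₗ[ℂ] H).rank ≤
        ((m + n : ℕ) : Cardinal.{u}) := by
      rw [ContinuousLinearMap.toLinearMap_add, Nat.cast_add]
      refine (LinearMap.rank_add_le _ _).trans (add_le_add ?_ ?_)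
      · exact (LinearMap.rank_comp_le_left _ (F : H →ₗ[ℂ] H)).trans hF
      · exact (LinearMap.rank_comp_le_right (G : H →ₗ[ℂ] H) (S : H →ₗ[ℂ] H)).trans hG
    calc _ ≤ ‖S * T - (F * (T - G) + S * G)‖ := singularNumber_le hr
      _ = ‖(S - F) * (T - G)‖ := by congr 1; noncomm_ring
      _ ≤ ‖S - F‖ * ‖T - G‖ := norm_mul_le _ _
      _ ≤ _ := by
        have := singularNumber_nonneg S m
        gcongr
  have hlim : Tendsto (fun ε : ℝ => (singularNumber S m + ε) * (singularNumber T n + ε))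
      (𝓝[>] 0) (𝓝 ((singularNumber S m + 0) * (singularNumber T n + 0))) :=
    Tendsto.mono_left (Continuous.tendsto (by fun_prop) 0) nhdsWithin_le_nhds
  rw [add_zero, add_zero] at hlim
  exact ge_of_tendsto hlim (eventually_mem_nhdsWithin.mono key)

theorem singularNumber_smul_le (c : ℂ) (T : H →L[ℂ] H) (n : ℕ) :
    singularNumber (c • T) n ≤ ‖c‖ * singularNumber T n := by
  have h := singularNumber_mul_le (c • (1 : H →L[ℂ] H)) T 0 n
  rw [zero_add, smul_mul_assoc, one_mul] at h
  refine h.trans (mul_le_mul_of_nonneg_right ?_ (singularNumber_nonneg T n))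
  refine (singularNumber_le_norm _ _).trans ((ContinuousLinearMap.opNorm_smul_le _ _).trans ?_)
  exact mul_le_of_le_one_right (norm_nonneg c) ContinuousLinearMap.norm_id_le

end SingularNumbers

/-! ### Schatten sums: quasi-triangle and Hölder inequalities, finite rank approximation. -/

section SchattenSums

variable {H : Type u} [NormedAddCommGroup H] [InnerProductSpace ℂ H]

/-- Pays for the doubled index in `s_{2n}(S + T) ≤ s_n(S) + s_n(T)` and in the analogous bound for
products. -/
theorem ENNReal.tsum_le_two_mul_tsum_even {f : ℕ → ℝ≥0∞} (hf : Antitone f) :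
    ∑' n, f n ≤ 2 * ∑' n, f (2 * n) := by
  rw [← tsum_even_add_odd (f := f) ENNReal.summable ENNReal.summable, two_mul]
  gcongr with n
  exact hf (Nat.le_succ _)

theorem ENNReal.add_rpow_le_two_rpow_mul (a b : ℝ≥0∞) {p : ℝ} (hp : 0 ≤ p) :
    (a + b) ^ p ≤ 2 ^ p * (a ^ p + b ^ p) := by
  have h : a + b ≤ 2 * max a b := by
    rw [two_mul]; exact add_le_add (le_max_left _ _) (le_max_right _ _)
  refine (ENNReal.rpow_le_rpow h hp).trans ?_
  rw [ENNReal.mul_rpow_of_nonneg _ _ hp]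
  gcongr
  rcases max_choice a b with h | h <;> rw [h]
  exacts [le_self_add, le_add_self]

/-- The sum `∑ s_n(T) ^ p` of the powers of the singular numbers. -/
noncomputable def schattenSum (p : ℝ) (T : H →L[ℂ] H) : ℝ≥0∞ :=
  ∑' n, ENNReal.ofReal (singularNumber T n) ^ p

theorem isSchatten_iff (p : ℕ) (T : H →L[ℂ] H) : IsSchatten p T ↔ schattenSum p T ≠ ∞ := by
  have h : ∀ n, ENNReal.ofReal (singularNumber T n) ^ (p : ℝ) =
      ENNReal.ofReal (singularNumber T n ^ p) := fun n => by
    rw [ENNReal.rpow_natCast, ENNReal.ofReal_pow (singularNumber_nonneg T n)]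
  simp only [schattenSum, h, IsSchatten]
  refine ⟨fun hs => hs.tsum_ofReal_ne_top, fun hs => ?_⟩
  have := ENNReal.summable_toReal hs
  simpa only [ENNReal.toReal_ofReal (pow_nonneg (singularNumber_nonneg T _) p)] using this

theorem enorm_rpow_le_schattenSum (p : ℝ) (T : H →L[ℂ] H) : ‖T‖ₑ ^ p ≤ schattenSum p T := by
  have h := ENNReal.le_tsum (f := fun n => ENNReal.ofReal (singularNumber T n) ^ p) 0
  rwa [singularNumber_zero_right, ofReal_norm] at h

theorem schattenSum_antitone_terms (T : H →L[ℂ] H) {p : ℝ} (hp : 0 ≤ p) :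
    Antitone fun n => ENNReal.ofReal (singularNumber T n) ^ p := fun _ _ h =>
  ENNReal.rpow_le_rpow (ENNReal.ofReal_le_ofReal (singularNumber_antitone T h)) hp

theorem schattenSum_add_le (S T : H →L[ℂ] H) {p : ℝ} (hp : 0 ≤ p) :
    schattenSum p (S + T) ≤ 2 * 2 ^ p * (schattenSum p S + schattenSum p T) := by
  refine (ENNReal.tsum_le_two_mul_tsum_even (schattenSum_antitone_terms _ hp)).trans ?_
  rw [mul_assoc, schattenSum, schattenSum, ← ENNReal.tsum_add,
    ← ENNReal.tsum_mul_left (a := 2 ^ p)]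
  refine mul_le_mul_right (ENNReal.tsum_le_tsum fun n => ?_) 2
  refine le_trans ?_ (ENNReal.add_rpow_le_two_rpow_mul _ _ hp)
  rw [← ENNReal.ofReal_add (singularNumber_nonneg S n) (singularNumber_nonneg T n), two_mul]
  exact ENNReal.rpow_le_rpow (ENNReal.ofReal_le_ofReal (singularNumber_add_le S T n n)) hp

theorem schattenSum_mul_le_left (S T : H →L[ℂ] H) {p : ℝ} (hp : 0 ≤ p) :
    schattenSum p (S * T) ≤ ‖S‖ₑ ^ p * schattenSum p T := by
  rw [schattenSum, schattenSum, ← ENNReal.tsum_mul_left]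
  gcongr with n
  rw [← ENNReal.mul_rpow_of_nonneg _ _ hp, ← ofReal_norm, ← ENNReal.ofReal_mul (norm_nonneg _)]
  gcongr
  simpa [singularNumber_zero_right] using singularNumber_mul_le S T 0 n

theorem schattenSum_mul_le_right (S T : H →L[ℂ] H) {p : ℝ} (hp : 0 ≤ p) :
    schattenSum p (S * T) ≤ schattenSum p S * ‖T‖ₑ ^ p := by
  rw [schattenSum, schattenSum, ← ENNReal.tsum_mul_right]
  gcongr with n
  rw [← ENNReal.mul_rpow_of_nonneg _ _ hp, ← ofReal_norm,
    ← ENNReal.ofReal_mul (singularNumber_nonneg S n)]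
  gcongr
  simpa [singularNumber_zero_right] using singularNumber_mul_le S T n 0

theorem schattenSum_smul_le (c : ℂ) (T : H →L[ℂ] H) {p : ℝ} (hp : 0 ≤ p) :
    schattenSum p (c • T) ≤ ‖c‖ₑ ^ p * schattenSum p T := by
  rw [schattenSum, schattenSum, ← ENNReal.tsum_mul_left]
  gcongr with n
  rw [← ENNReal.mul_rpow_of_nonneg _ _ hp, ← ofReal_norm, ← ENNReal.ofReal_mul (norm_nonneg _)]
  gcongr
  exact singularNumber_smul_le c T n

theorem schattenSum_neg_le (T : H →L[ℂ] H) {p : ℝ} (hp : 0 ≤ p) :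
    schattenSum p (-T) ≤ schattenSum p T := by
  simpa using schattenSum_smul_le (-1) T hp

/-- Hölder's inequality for Schatten classes, up to a constant. -/
theorem schattenSum_mul_le_of_holder (S T : H →L[ℂ] H) {p q r : ℝ} (hp : 0 < p) (hq : 0 < q)
    (hr : 0 < r) (h : 1 / r = 1 / p + 1 / q) :
    schattenSum r (S * T) ≤ 2 * (schattenSum p S ^ (r / p) * schattenSum q T ^ (r / q)) := by
  have hrp : r < p := by
    have h2 : 1 / p < 1 / r := by rw [h]; linarith [one_div_pos.2 hq]
    exact (one_div_lt_one_div hp hr).1 h2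
  -- Hölder for sequences is Hölder for the counting measure on `ℕ`.
  have hold := ENNReal.lintegral_Lp_mul_le_Lq_mul_Lr hr hrp h
    (MeasureTheory.Measure.count (α := ℕ)) (f := fun n => ENNReal.ofReal (singularNumber S n))
    (g := fun n => ENNReal.ofReal (singularNumber T n))
    (measurable_from_nat.aemeasurable) (measurable_from_nat.aemeasurable)
  simp only [MeasureTheory.lintegral_count] at hold
  have hold2 := ENNReal.rpow_le_rpow hold hr.le
  rw [ENNReal.mul_rpow_of_nonneg _ _ hr.le, ← ENNReal.rpow_mul, ← ENNReal.rpow_mul,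
    ← ENNReal.rpow_mul, one_div_mul_cancel hr.ne', ENNReal.rpow_one, one_div_mul_eq_div,
    one_div_mul_eq_div] at hold2
  refine (ENNReal.tsum_le_two_mul_tsum_even (schattenSum_antitone_terms _ hr.le)).trans ?_
  refine mul_le_mul_right ((ENNReal.tsum_le_tsum fun n => ?_).trans hold2) 2
  rw [two_mul, Pi.mul_apply, ← ENNReal.ofReal_mul (singularNumber_nonneg S n)]
  gcongr
  exact singularNumber_mul_le S T n n

theorem schattenSum_le_of_rank_le {F : H →L[ℂ] H} {n : ℕ} {p : ℝ} (hp : 0 < p)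
    (hF : (F : H →ₗ[ℂ] H).rank ≤ (n : Cardinal.{u})) : schattenSum p F ≤ n * ‖F‖ₑ ^ p := by
  have hz : ∀ m ∉ Finset.range n, ENNReal.ofReal (singularNumber F m) ^ p = 0 := by
    intro m hm
    rw [singularNumber_eq_zero_of_rank_le (hF.trans (by simpa using hm)), ENNReal.ofReal_zero,
      ENNReal.zero_rpow_of_pos hp]
  rw [schattenSum, tsum_eq_sum hz]
  refine (Finset.sum_le_card_nsmul _ _ (‖F‖ₑ ^ p) fun m _ => ?_).trans (by simp)
  rw [← ofReal_norm]
  gcongr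
  exact singularNumber_le_norm F m

/-- Take `F` of rank at most `2n` and nearly optimal. The first `4n` singular numbers of `T - F` are
at most `s_{2n}(T) + δ`; the later ones are bounded by a tail of those of `T`. Since `n s_{2n}^p ≤
∑_{n ≤ j < 2n} s_j^p`, the head is a tail too, up to `δ`. So `n` is chosen to make the tail small,
and then `δ` in terms of `n`. -/
theorem exists_rank_le_schattenSum_sub_le {T : H →L[ℂ] H} {p : ℝ} (hp : 0 < p)
    (hT : schattenSum p T ≠ ∞) {ε : ℝ≥0∞} (hε : ε ≠ 0) :
    ∃ (n : ℕ) (F : H →L[ℂ] H), (F : H →ₗ[ℂ] H).rank ≤ (n : Cardinal.{u}) ∧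
      schattenSum p (T - F) ≤ ε := by
  set f : ℕ → ℝ≥0∞ := fun n => ENNReal.ofReal (singularNumber T n) ^ p with hf
  have hanti : Antitone f := schattenSum_antitone_terms T hp.le
  have h2p : (2 : ℝ≥0∞) ^ p ≠ ∞ := ENNReal.rpow_ne_top_of_nonneg hp.le (by simp)
  have htail : Tendsto (fun n => (2 ^ p * 4 + 1) * ∑' j, f (j + n)) atTop (𝓝 0) := by
    have := ENNReal.Tendsto.const_mul (a := 2 ^ p * 4 + 1) (ENNReal.tendsto_sum_nat_add f hT)
      (Or.inr (by finiteness))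
    simpa using this
  obtain ⟨n, hn⟩ := (htail.eventually_le_const (pos_iff_ne_zero.2 (ENNReal.half_pos hε).ne')).exists
  have hδ : Tendsto (fun δ : ℝ => (4 * n : ℝ≥0∞) * (2 ^ p * ENNReal.ofReal δ ^ p)) (𝓝[>] 0)
      (𝓝 0) := by
    have h1 : Tendsto (fun δ : ℝ => ENNReal.ofReal δ ^ p) (𝓝[>] 0) (𝓝 0) := by
      have : Tendsto (fun δ : ℝ => ENNReal.ofReal δ ^ p) (𝓝 0) (𝓝 (ENNReal.ofReal 0 ^ p)) :=
        ((ENNReal.continuous_rpow_const (y := p)).comp ENNReal.continuous_ofReal).tendsto 0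
      rw [ENNReal.ofReal_zero, ENNReal.zero_rpow_of_pos hp] at this
      exact this.mono_left nhdsWithin_le_nhds
    have := ENNReal.Tendsto.const_mul (a := 4 * n) (ENNReal.Tendsto.const_mul (a := 2 ^ p) h1
      (Or.inr h2p)) (Or.inr (by finiteness))
    simpa using this
  obtain ⟨δ, hδε, hδ0⟩ := ((hδ.eventually_le_const
    (pos_iff_ne_zero.2 (ENNReal.half_pos hε).ne')).and self_mem_nhdsWithin).exists
  obtain ⟨F, hF, hTF⟩ := exists_norm_sub_lt_singularNumber_add T (2 * n) hδ0
  refine ⟨2 * n, F, hF, ?_⟩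
  have hnegF : singularNumber (-F) (2 * n) = 0 := by
    refine le_antisymm ?_ (singularNumber_nonneg _ _)
    simpa [singularNumber_eq_zero_of_rank_le hF] using singularNumber_smul_le (-1) F (2 * n)
  have hhead : ∀ m ∈ Finset.range (4 * n), ENNReal.ofReal (singularNumber (T - F) m) ^ p ≤
      2 ^ p * (f (2 * n) + ENNReal.ofReal δ ^ p) := by
    intro m _
    refine le_trans ?_ (ENNReal.add_rpow_le_two_rpow_mul _ _ hp.le)
    rw [← ENNReal.ofReal_add (singularNumber_nonneg _ _) (le_of_lt hδ0)]
    gcongr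
    exact (singularNumber_le_norm _ _).trans hTF.le
  have htl : ∀ j, ENNReal.ofReal (singularNumber (T - F) (j + 4 * n)) ^ p ≤ f (j + n) := by
    intro j
    refine le_trans ?_ (hanti (show j + n ≤ j + 2 * n by omega))
    simp only [hf]
    gcongr
    have := singularNumber_add_le T (-F) (j + 2 * n) (2 * n)
    rwa [hnegF, add_zero, ← sub_eq_add_neg, show j + 2 * n + 2 * n = j + 4 * n by ring] at this
  have hnf : (n : ℝ≥0∞) * f (2 * n) ≤ ∑' j, f (j + n) := by
    refine le_trans ?_ (ENNReal.sum_le_tsum (Finset.range n))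
    rw [← nsmul_eq_mul, ← Finset.card_range n, ← Finset.sum_const, Finset.card_range]
    refine Finset.sum_le_sum fun j hj => hanti ?_
    have := Finset.mem_range.1 hj
    omega
  have hsplit : schattenSum p (T - F) =
      ∑ m ∈ Finset.range (4 * n), ENNReal.ofReal (singularNumber (T - F) m) ^ p +
        ∑' j, ENNReal.ofReal (singularNumber (T - F) (j + 4 * n)) ^ p :=
    (ENNReal.summable.sum_add_tsum_nat_add' (k := 4 * n)).symm
  rw [hsplit]
  calc _ ≤ (4 * n : ℝ≥0∞) * (2 ^ p * (f (2 * n) + ENNReal.ofReal δ ^ p)) + ∑' j, f (j + n) := by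
        refine add_le_add ((Finset.sum_le_sum hhead).trans ?_) (ENNReal.tsum_le_tsum htl)
        rw [Finset.sum_const, Finset.card_range, nsmul_eq_mul]
        push_cast
        rfl
    _ = 2 ^ p * 4 * (n * f (2 * n)) + ∑' j, f (j + n) +
          (4 * n : ℝ≥0∞) * (2 ^ p * ENNReal.ofReal δ ^ p) := by ring
    _ ≤ 2 ^ p * 4 * (∑' j, f (j + n)) + ∑' j, f (j + n) + ε / 2 := by gcongr
    _ = (2 ^ p * 4 + 1) * (∑' j, f (j + n)) + ε / 2 := by ring
    _ ≤ ε / 2 + ε / 2 := by gcongr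
    _ = ε := ENNReal.add_halves ε

end SchattenSums

/-! ### Convergence in Schatten classes and its behaviour under products. -/

section SchattenConvergence

variable {H : Type u} [NormedAddCommGroup H] [InnerProductSpace ℂ H] {α : Type*} {l : Filter α}

theorem tendsto_schattenSum_add {p : ℝ} (hp : 0 < p) {S T : α → H →L[ℂ] H}
    (hS : Tendsto (fun s => schattenSum p (S s)) l (𝓝 0))
    (hT : Tendsto (fun s => schattenSum p (T s)) l (𝓝 0)) :
    Tendsto (fun s => schattenSum p (S s + T s)) l (𝓝 0) := by
  have h2p : (2 : ℝ≥0∞) ^ p ≠ ∞ := ENNReal.rpow_ne_top_of_nonneg hp.le (by simp)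
  have := ENNReal.Tendsto.const_mul (a := 2 * 2 ^ p) (hS.add hT) (Or.inr (by finiteness))
  rw [add_zero, mul_zero] at this
  exact tendsto_of_tendsto_of_tendsto_of_le_of_le tendsto_const_nhds this (fun _ => zero_le)
    fun s => schattenSum_add_le _ _ hp.le

theorem ENNReal.Tendsto.rpow_mul_rpow_zero {x y : α → ℝ≥0∞} {a b : ℝ≥0∞} (ha : a ≠ ∞)
    (hb : b ≠ ∞) (hab : a = 0 ∨ b = 0) (hx : Tendsto x l (𝓝 a)) (hy : Tendsto y l (𝓝 b))
    {c d : ℝ} (hc : 0 < c) (hd : 0 < d) :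
    Tendsto (fun s => x s ^ c * y s ^ d) l (𝓝 0) := by
  have hac : a ^ c ≠ ∞ := ENNReal.rpow_ne_top_of_nonneg hc.le ha
  have hbd : b ^ d ≠ ∞ := ENNReal.rpow_ne_top_of_nonneg hd.le hb
  have := ENNReal.Tendsto.mul (((ENNReal.continuous_rpow_const (y := c)).tendsto a).comp hx)
    (Or.inr hbd) (((ENNReal.continuous_rpow_const (y := d)).tendsto b).comp hy) (Or.inr hac)
  have h0 : a ^ c * b ^ d = 0 := by
    rcases hab with rfl | rfl
    · rw [ENNReal.zero_rpow_of_pos hc, zero_mul]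
    · rw [ENNReal.zero_rpow_of_pos hd, mul_zero]
  rwa [h0] at this

theorem tendsto_schattenSum_mul {p q r : ℝ} (hp : 0 < p) (hq : 0 < q) (hr : 0 < r)
    (h : 1 / r = 1 / p + 1 / q) {S T : α → H →L[ℂ] H} {a b : ℝ≥0∞} (ha : a ≠ ∞) (hb : b ≠ ∞)
    (hab : a = 0 ∨ b = 0) (hS : Tendsto (fun s => schattenSum p (S s)) l (𝓝 a))
    (hT : Tendsto (fun s => schattenSum q (T s)) l (𝓝 b)) :
    Tendsto (fun s => schattenSum r (S s * T s)) l (𝓝 0) := by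
  have := ENNReal.Tendsto.const_mul (a := 2) (ENNReal.Tendsto.rpow_mul_rpow_zero ha hb hab hS hT
    (div_pos hr hp) (div_pos hr hq)) (Or.inr (by simp))
  rw [mul_zero] at this
  exact tendsto_of_tendsto_of_tendsto_of_le_of_le tendsto_const_nhds this (fun _ => zero_le)
    fun s => schattenSum_mul_le_of_holder _ _ hp hq hr h

theorem tendsto_schattenSum_mul_right {p : ℝ} (hp : 0 < p)
    {S T : α → H →L[ℂ] H} {a b : ℝ≥0∞} (ha : a ≠ ∞) (hb : b ≠ ∞)
    (hab : a = 0 ∨ b = 0) (hS : Tendsto (fun s => schattenSum p (S s)) l (𝓝 a))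
    (hT : Tendsto (fun s => ‖T s‖ₑ) l (𝓝 b)) :
    Tendsto (fun s => schattenSum p (S s * T s)) l (𝓝 0) := by
  have := ENNReal.Tendsto.rpow_mul_rpow_zero ha hb hab hS hT one_pos hp
  simp only [ENNReal.rpow_one] at this
  exact tendsto_of_tendsto_of_tendsto_of_le_of_le tendsto_const_nhds this (fun _ => zero_le)
    fun s => schattenSum_mul_le_right _ _ hp.le

/-- `T s → T₀` in the Schatten class of exponent `p`. -/
def SchattenTendsto (p : ℝ) (l : Filter α) (T : α → H →L[ℂ] H) (T₀ : H →L[ℂ] H) : Prop :=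
  schattenSum p T₀ ≠ ∞ ∧ Tendsto (fun s => schattenSum p (T s - T₀)) l (𝓝 0)

namespace SchattenTendsto

variable {p q r : ℝ} {S T : α → H →L[ℂ] H} {S₀ T₀ : H →L[ℂ] H}

theorem tendsto (hp : 0 < p) (h : SchattenTendsto p l T T₀) : Tendsto T l (𝓝 T₀) := by
  rw [tendsto_iff_edist_tendsto_0]
  have h1 : Tendsto (fun s => ‖T s - T₀‖ₑ ^ p) l (𝓝 0) :=
    tendsto_of_tendsto_of_tendsto_of_le_of_le tendsto_const_nhds h.2 (fun _ => zero_le)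
      fun s => enorm_rpow_le_schattenSum p _
  have h2 := ((ENNReal.continuous_rpow_const (y := p⁻¹)).tendsto 0).comp h1
  rw [ENNReal.zero_rpow_of_pos (inv_pos.2 hp)] at h2
  refine h2.congr fun s => ?_
  simp only [Function.comp_apply]
  rw [← ENNReal.rpow_mul, mul_inv_cancel₀ hp.ne', ENNReal.rpow_one, edist_eq_enorm_sub]

theorem schattenSum_add_ne_top (hp : 0 < p) (hS : schattenSum p S₀ ≠ ∞)
    (hT : schattenSum p T₀ ≠ ∞) : schattenSum p (S₀ + T₀) ≠ ∞ := by
  have h2p : (2 : ℝ≥0∞) ^ p ≠ ∞ := ENNReal.rpow_ne_top_of_nonneg hp.le (by simp)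
  exact ne_top_of_le_ne_top (by finiteness) (schattenSum_add_le S₀ T₀ hp.le)

theorem add (hp : 0 < p) (hS : SchattenTendsto p l S S₀) (hT : SchattenTendsto p l T T₀) :
    SchattenTendsto p l (fun s => S s + T s) (S₀ + T₀) := by
  refine ⟨schattenSum_add_ne_top hp hS.1 hT.1, ?_⟩
  simp only [add_sub_add_comm]
  exact tendsto_schattenSum_add hp hS.2 hT.2

theorem mul_of_tendsto (hp : 0 < p) (hS : SchattenTendsto p l S S₀) (hT : Tendsto T l (𝓝 T₀)) :
    SchattenTendsto p l (fun s => S s * T s) (S₀ * T₀) := by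
  refine ⟨ne_top_of_le_ne_top (ENNReal.mul_ne_top hS.1 (ENNReal.rpow_ne_top_of_nonneg hp.le
    enorm_ne_top)) (schattenSum_mul_le_right S₀ T₀ hp.le), ?_⟩
  have h1 := tendsto_schattenSum_mul_right hp (by simp) enorm_ne_top (Or.inl rfl) hS.2 hT.enorm
  have hT0 : Tendsto (fun s => ‖T s - T₀‖ₑ) l (𝓝 0) := by
    simpa [edist_eq_enorm_sub] using tendsto_iff_edist_tendsto_0.1 hT
  have h2 := tendsto_schattenSum_mul_right hp hS.1 (by simp) (Or.inr rfl)
    (tendsto_const_nhds (x := schattenSum p S₀) (f := l)) hT0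
  refine (tendsto_schattenSum_add hp h1 h2).congr fun s => ?_
  congr 1
  noncomm_ring

theorem smul (hp : 0 < p) (c : ℂ) (hS : SchattenTendsto p l S S₀) :
    SchattenTendsto p l (fun s => c • S s) (c • S₀) := by
  simpa using hS.mul_of_tendsto hp (tendsto_const_nhds (x := c • (1 : H →L[ℂ] H)))

theorem neg (hp : 0 < p) (hS : SchattenTendsto p l S S₀) :
    SchattenTendsto p l (fun s => -S s) (-S₀) := by
  simpa using hS.smul hp (-1)

theorem mul (hp : 0 < p) (hq : 0 < q) (hr : 0 < r) (h : 1 / r = 1 / p + 1 / q)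
    (hS : SchattenTendsto p l S S₀) (hT : SchattenTendsto q l T T₀) :
    SchattenTendsto r l (fun s => S s * T s) (S₀ * T₀) := by
  refine ⟨ne_top_of_le_ne_top (ENNReal.mul_ne_top (by simp) (ENNReal.mul_ne_top
    (ENNReal.rpow_ne_top_of_nonneg (div_pos hr hp).le hS.1)
    (ENNReal.rpow_ne_top_of_nonneg (div_pos hr hq).le hT.1)))
    (schattenSum_mul_le_of_holder S₀ T₀ hp hq hr h), ?_⟩
  have h1 := tendsto_schattenSum_mul hp hq hr h (by simp) (by simp) (Or.inl rfl) hS.2 hT.2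
  have h2 := tendsto_schattenSum_mul hp hq hr h (by simp) hT.1 (Or.inl rfl) hS.2
    tendsto_const_nhds
  have h3 := tendsto_schattenSum_mul hp hq hr h hS.1 (by simp) (Or.inr rfl)
    (tendsto_const_nhds (x := schattenSum p S₀) (f := l)) hT.2
  refine (tendsto_schattenSum_add hr (tendsto_schattenSum_add hr h1 h2) h3).congr fun s => ?_
  congr 1
  noncomm_ring

theorem list_prod {β : Type*} {W : β → α → H →L[ℂ] H} {W₀ : β → H →L[ℂ] H} (hp : 0 < p)
    (hW : ∀ b, SchattenTendsto p l (W b) (W₀ b)) (w : List β) (hw : w ≠ []) :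
    SchattenTendsto (p / w.length) l (fun s => (w.map (W · s)).prod) ((w.map W₀).prod) := by
  induction w with
  | nil => exact absurd rfl hw
  | cons b w ih =>
    rcases eq_or_ne w [] with rfl | hw'
    · simpa using hW b
    · have hl : (0 : ℝ) < w.length := by exact_mod_cast List.length_pos_iff.2 hw'
      simp only [List.map_cons, List.prod_cons, List.length_cons]
      refine (hW b).mul hp (div_pos hp hl) (by positivity) ?_ (ih hw')
      push_cast
      field_simp
      ring

/-- By Hölder the first `k` factors already converge in the trace class; from the others only norm
convergence is needed. -/
theorem list_prod_of_le_length {β : Type*} {W : β → α → H →L[ℂ] H} {W₀ : β → H →L[ℂ] H} {k : ℕ}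
    (hk : 1 ≤ k) (hW : ∀ b, SchattenTendsto k l (W b) (W₀ b)) (w : List β) (hw : k ≤ w.length) :
    SchattenTendsto 1 l (fun s => (w.map (W · s)).prod) ((w.map W₀).prod) := by
  have hk' : (0 : ℝ) < k := by exact_mod_cast hk
  have hlen : (w.take k).length = k := by simpa using hw
  have h1 := list_prod hk' hW (w.take k) (by
    intro h
    rw [h] at hlen
    simp at hlen
    omega)
  rw [hlen, div_self hk'.ne'] at h1
  have h2 : Tendsto (fun s => ((w.drop k).map (W · s)).prod) l (𝓝 ((w.drop k).map W₀).prod) :=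
    tendsto_list_prod _ fun b _ => (hW b).tendsto hk'
  have h3 := h1.mul_of_tendsto one_pos h2
  simpa only [← List.prod_append, ← List.map_append, List.take_append_drop] using h3

end SchattenTendsto

end SchattenConvergence

/-! ### Diagonal sums are bounded by the trace class size, uniformly in the section. -/

section TraceBound

variable {H : Type u} [NormedAddCommGroup H] [InnerProductSpace ℂ H]

/-- The `u j` form an orthonormal basis of the range and `v j` is the adjoint applied to `u j`. -/
theorem exists_sum_inner_smul_of_rank_le [CompleteSpace H] {F : H →L[ℂ] H} {n : ℕ}
    (hF : (F : H →ₗ[ℂ] H).rank ≤ (n : Cardinal.{u})) :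
    ∃ r ≤ n, ∃ u v : Fin r → H, (∀ j, ‖u j‖ = 1) ∧ (∀ j, ‖v j‖ ≤ ‖F‖) ∧
      ∀ x, F x = ∑ j, inner ℂ (v j) x • u j := by
  have : FiniteDimensional ℂ (LinearMap.range (F : H →ₗ[ℂ] H)) :=
    Module.rank_lt_aleph0_iff.1 (hF.trans_lt Cardinal.natCast_lt_aleph0)
  let e := stdOrthonormalBasis ℂ (LinearMap.range (F : H →ₗ[ℂ] H))
  have hu : ∀ j, ‖(e j : H)‖ = 1 := fun j => e.orthonormal.1 j
  refine ⟨_, Module.finrank_le_of_rank_le hF, fun j => (e j : H),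
    fun j => ContinuousLinearMap.adjoint F (e j), hu, fun j => ?_, fun x => ?_⟩
  · refine (ContinuousLinearMap.le_opNorm _ _).trans ?_
    rw [hu, mul_one, LinearIsometryEquiv.norm_map]
  · have h : _ = F x := congrArg Subtype.val (e.sum_repr ⟨F x, LinearMap.mem_range_self _ x⟩)
    rw [← h, AddSubmonoidClass.coe_finsetSum]
    refine Finset.sum_congr rfl fun j _ => ?_
    rw [ContinuousLinearMap.adjoint_inner_left, e.repr_apply_apply]
    rfl

variable {ι : Type*} {b : ι → H}

theorem sum_norm_inner_mul_inner_le (hb : Orthonormal ℂ b) (s : Finset ι) (x y : H) :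
    ∑ i ∈ s, ‖inner ℂ x (b i) * inner ℂ (b i) y‖ ≤ ‖x‖ * ‖y‖ := by
  simp only [norm_mul, fun i => norm_inner_symm (𝕜 := ℂ) x (b i)]
  refine (Real.sum_mul_le_sqrt_mul_sqrt s _ _).trans ?_
  gcongr
  · exact Real.sqrt_le_iff.2 ⟨norm_nonneg x, hb.sum_inner_products_le x⟩
  · exact Real.sqrt_le_iff.2 ⟨norm_nonneg y, hb.sum_inner_products_le y⟩

theorem sum_norm_inner_apply_le_of_rank_le [CompleteSpace H] (hb : Orthonormal ℂ b)
    (s : Finset ι) {F : H →L[ℂ] H} {n : ℕ} (hF : (F : H →ₗ[ℂ] H).rank ≤ (n : Cardinal.{u})) :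
    ∑ i ∈ s, ‖inner ℂ (b i) (F (b i))‖ ≤ n * ‖F‖ := by
  obtain ⟨r, hr, u, v, hu, hv, h⟩ := exists_sum_inner_smul_of_rank_le hF
  calc ∑ i ∈ s, ‖inner ℂ (b i) (F (b i))‖
      ≤ ∑ i ∈ s, ∑ j, ‖inner ℂ (v j) (b i) * inner ℂ (b i) (u j)‖ := by
        refine Finset.sum_le_sum fun i _ => ?_
        rw [h, inner_sum]
        simp only [inner_smul_right]
        exact norm_sum_le _ _
    _ = ∑ j, ∑ i ∈ s, ‖inner ℂ (v j) (b i) * inner ℂ (b i) (u j)‖ := Finset.sum_comm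
    _ ≤ ∑ _j : Fin r, ‖F‖ := by
        refine Finset.sum_le_sum fun j _ => (sum_norm_inner_mul_inner_le hb s _ _).trans ?_
        rw [hu, mul_one]
        exact hv j
    _ ≤ n * ‖F‖ := by
        rw [Finset.sum_const, Finset.card_univ, Fintype.card_fin, nsmul_eq_mul]
        gcongr

theorem sum_norm_inner_apply_add_le (b : ι → H) (s : Finset ι) (S T : H →L[ℂ] H) :
    ∑ i ∈ s, ‖inner ℂ (b i) ((S + T) (b i))‖ ≤
      ∑ i ∈ s, ‖inner ℂ (b i) (S (b i))‖ + ∑ i ∈ s, ‖inner ℂ (b i) (T (b i))‖ := by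
  rw [← Finset.sum_add_distrib]
  refine Finset.sum_le_sum fun i _ => ?_
  rw [_root_.add_apply, inner_add_right]
  exact norm_add_le _ _

theorem norm_inner_apply_le_norm (hb : Orthonormal ℂ b) (T : H →L[ℂ] H) (i j : ι) :
    ‖inner ℂ (b i) (T (b j))‖ ≤ ‖T‖ := by
  refine (norm_inner_le_norm _ _).trans ?_
  rw [hb.1, one_mul]
  simpa [hb.1] using T.le_opNorm (b j)

theorem sum_norm_inner_apply_le_card (hb : Orthonormal ℂ b) (s : Finset ι) (T : H →L[ℂ] H) :
    ∑ i ∈ s, ‖inner ℂ (b i) (T (b i))‖ ≤ s.card * ‖T‖ := by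
  refine (Finset.sum_le_card_nsmul _ _ ‖T‖ fun i _ => norm_inner_apply_le_norm hb T i i).trans ?_
  simp

/-- Telescope `T = F_0 + ∑ (F_{m+1} - F_m) + (T - F_N)` through near-optimal `F_m` of rank at most
`2^m`. A difference has rank at most `3 · 2^m` and norm about `2 s_{2^m}` at most, whence the `6`.
The last piece is estimated by the number of diagonal entries, which is at most `2^N`. -/
theorem sum_norm_inner_apply_le_dyadic [CompleteSpace H] (hb : Orthonormal ℂ b) (s : Finset ι)
    (T : H →L[ℂ] H) {N : ℕ} (hN : s.card ≤ 2 ^ N) :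
    ∑ i ∈ s, ‖inner ℂ (b i) (T (b i))‖ ≤
      2 * ‖T‖ + 6 * ∑ m ∈ Finset.range (N + 1), 2 ^ m * singularNumber T (2 ^ m) := by
  set φ : (H →L[ℂ] H) → ℝ := fun T => ∑ i ∈ s, ‖inner ℂ (b i) (T (b i))‖ with hφ
  have hadd : ∀ S T, φ (S + T) ≤ φ S + φ T := sum_norm_inner_apply_add_le b s
  have key : ∀ δ : ℝ, 0 < δ → φ T ≤ 2 * ‖T‖ + δ +
      6 * ∑ m ∈ Finset.range (N + 1), 2 ^ m * (singularNumber T (2 ^ m) + δ) := by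
    intro δ hδ
    choose F hF hTF using fun m : ℕ => exists_norm_sub_lt_singularNumber_add T (2 ^ m) hδ
    have hstep : ∀ m, φ (F (m + 1) - F m) ≤ 6 * (2 ^ m * (singularNumber T (2 ^ m) + δ)) := by
      intro m
      have hr : ((F (m + 1) - F m : H →L[ℂ] H) : H →ₗ[ℂ] H).rank ≤
          ((3 * 2 ^ m : ℕ) : Cardinal.{u}) := by
        rw [sub_eq_add_neg, ContinuousLinearMap.toLinearMap_add,
          show 3 * 2 ^ m = 2 ^ (m + 1) + 2 ^ m by ring, Nat.cast_add]
        refine (LinearMap.rank_add_le _ _).trans (add_le_add (hF (m + 1)) (le_trans ?_ (hF m)))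
        exact LinearMap.rank_comp_le_right (F m : H →ₗ[ℂ] H) (-LinearMap.id)
      have hn : ‖F (m + 1) - F m‖ ≤ 2 * (singularNumber T (2 ^ m) + δ) := by
        have h1 := singularNumber_antitone T
          (show 2 ^ m ≤ 2 ^ (m + 1) from Nat.pow_le_pow_right (by simp) (Nat.le_succ m))
        have h2 := norm_sub_le (T - F m) (T - F (m + 1))
        rw [sub_sub_sub_cancel_left] at h2
        linarith [hTF m, hTF (m + 1)]
      refine (sum_norm_inner_apply_le_of_rank_le hb s hr).trans ?_
      push_cast
      calc (3 * 2 ^ m : ℝ) * ‖F (m + 1) - F m‖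
          ≤ 3 * 2 ^ m * (2 * (singularNumber T (2 ^ m) + δ)) := by gcongr
        _ = _ := by ring
    have htel : ∀ n, φ (F n) ≤ 2 * ‖T‖ + δ +
        6 * ∑ m ∈ Finset.range n, 2 ^ m * (singularNumber T (2 ^ m) + δ) := by
      intro n
      induction n with
      | zero =>
        have h1 := sum_norm_inner_apply_le_of_rank_le hb s (hF 0)
        have h2 := norm_sub_le T (T - F 0)
        rw [sub_sub_cancel] at h2
        have h3 := singularNumber_le_norm T (2 ^ 0)
        simp only [pow_zero, Nat.cast_one, one_mul] at h1
        simp only [Finset.range_zero, Finset.sum_empty, mul_zero, add_zero]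
        linarith [hTF 0]
      | succ n ih =>
        have h1 := hadd (F n) (F (n + 1) - F n)
        rw [add_sub_cancel] at h1
        rw [Finset.sum_range_succ]
        linarith [hstep n]
    have hlast : φ (T - F N) ≤ 2 ^ N * (singularNumber T (2 ^ N) + δ) := by
      refine (sum_norm_inner_apply_le_card hb s _).trans ?_
      have : (s.card : ℝ) ≤ 2 ^ N := by exact_mod_cast hN
      have := (hTF N).le
      gcongr
    have h1 := hadd (F N) (T - F N)
    rw [add_sub_cancel] at h1
    have h0 : 0 ≤ 2 ^ N * (singularNumber T (2 ^ N) + δ) :=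
      mul_nonneg (by positivity) (add_nonneg (singularNumber_nonneg _ _) hδ.le)
    rw [Finset.sum_range_succ]
    linarith [htel N]
  have hlim : Tendsto (fun δ : ℝ => 2 * ‖T‖ + δ +
      6 * ∑ m ∈ Finset.range (N + 1), 2 ^ m * (singularNumber T (2 ^ m) + δ)) (𝓝[>] 0)
      (𝓝 (2 * ‖T‖ + 0 +
      6 * ∑ m ∈ Finset.range (N + 1), 2 ^ m * (singularNumber T (2 ^ m) + 0))) :=
    Tendsto.mono_left (Continuous.tendsto (by fun_prop) 0) nhdsWithin_le_nhds
  simp only [add_zero] at hlim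
  exact ge_of_tendsto hlim (eventually_mem_nhdsWithin.mono key)

theorem ofReal_sum_norm_inner_apply_le [CompleteSpace H] (hb : Orthonormal ℂ b) (s : Finset ι)
    (T : H →L[ℂ] H) :
    ENNReal.ofReal (∑ i ∈ s, ‖inner ℂ (b i) (T (b i))‖) ≤ 20 * schattenSum 1 T := by
  have hσ : schattenSum 1 T = ∑' n, ENNReal.ofReal (singularNumber T n) := by
    simp only [schattenSum, ENNReal.rpow_one]
  refine (ENNReal.ofReal_le_ofReal (sum_norm_inner_apply_le_dyadic hb s T
    s.card.lt_two_pow_self.le)).trans ?_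
  have hnn := singularNumber_nonneg T
  rw [ENNReal.ofReal_add (by positivity) (mul_nonneg (by norm_num)
    (Finset.sum_nonneg fun m _ => mul_nonneg (by positivity) (hnn _))),
    ENNReal.ofReal_mul (by norm_num), ENNReal.ofReal_mul (by norm_num),
    ENNReal.ofReal_sum_of_nonneg fun m _ => mul_nonneg (by positivity) (hnn _)]
  have h1 : ENNReal.ofReal ‖T‖ ≤ schattenSum 1 T := by
    simpa using enorm_rpow_le_schattenSum 1 T
  -- Cauchy condensation; together with the bound for `‖T‖` it gives the constant `20 = 2 + 6 · 3`.
  have h2 : ∑ m ∈ Finset.range (s.card + 1), ENNReal.ofReal (2 ^ m * singularNumber T (2 ^ m)) ≤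
      3 * schattenSum 1 T := by
    have hc := ENNReal.tsum_condensed_le (f := fun n => ENNReal.ofReal (singularNumber T n))
      fun m n _ h => ENNReal.ofReal_le_ofReal (singularNumber_antitone T h)
    calc _ ≤ ∑' m, 2 ^ m * ENNReal.ofReal (singularNumber T (2 ^ m)) := by
          refine le_trans (le_of_eq (Finset.sum_congr rfl fun m _ => ?_))
            (ENNReal.sum_le_tsum (Finset.range (s.card + 1)))
          rw [ENNReal.ofReal_mul (by positivity), ENNReal.ofReal_pow (by norm_num),
            ENNReal.ofReal_ofNat]
      _ ≤ _ := hc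
      _ ≤ schattenSum 1 T + 2 * schattenSum 1 T := by
          rw [hσ]
          gcongr
          exact ENNReal.le_tsum 1
      _ = 3 * schattenSum 1 T := by ring
  calc _ ≤ 2 * schattenSum 1 T + 6 * (3 * schattenSum 1 T) := by
        rw [ENNReal.ofReal_ofNat, ENNReal.ofReal_ofNat]
        gcongr
    _ = 20 * schattenSum 1 T := by ring

theorem sum_norm_inner_apply_le [CompleteSpace H] (hb : Orthonormal ℂ b) (s : Finset ι)
    {T : H →L[ℂ] H} {c : ℝ} (hc : 0 ≤ c) (hT : schattenSum 1 T ≤ ENNReal.ofReal c) :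
    ∑ i ∈ s, ‖inner ℂ (b i) (T (b i))‖ ≤ 20 * c := by
  have h := (ofReal_sum_norm_inner_apply_le hb s T).trans (mul_le_mul_right hT 20)
  rw [← ENNReal.ofReal_ofNat, ← ENNReal.ofReal_mul (by norm_num)] at h
  exact (ENNReal.ofReal_le_ofReal_iff (by positivity)).1 h

end TraceBound

-- The eigenvalues `x ≥ 0` of `(1 + M)ᴴ(1 + M)` satisfy `x ≤ exp(x - 1)`. Their product is `|det(1 +
-- M)|²` and their sum is the size of the matrix plus the exponent on the right.
open scoped ComplexOrder in
theorem Matrix.norm_det_one_add_sq_le {n : Type*} [Fintype n] [DecidableEq n]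
    (M : Matrix n n ℂ) :
    ‖(1 + M).det‖ ^ 2 ≤ Real.exp (2 * M.trace.re + ∑ i, ∑ j, ‖M i j‖ ^ 2) := by
  have hP := Matrix.posSemidef_conjTranspose_mul_self (1 + M)
  set P := (1 + M).conjTranspose * (1 + M) with hPdef
  have hdet : ((‖(1 + M).det‖ ^ 2 : ℝ) : ℂ) = ((∏ i, hP.1.eigenvalues i : ℝ) : ℂ) := by
    have hd : P.det = ((‖(1 + M).det‖ ^ 2 : ℝ) : ℂ) := by
      rw [hPdef, Matrix.det_mul, Matrix.det_conjTranspose, ← starRingEnd_apply,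
        Complex.conj_mul', Complex.ofReal_pow]
    rw [← hd, Complex.ofReal_prod]
    exact hP.1.det_eq_prod_eigenvalues
  have htr : ∑ i, hP.1.eigenvalues i =
      Fintype.card n + (2 * M.trace.re + ∑ i, ∑ j, ‖M i j‖ ^ 2) := by
    have h := congrArg Complex.re hP.1.trace_eq_sum_eigenvalues
    have h2 : P.trace = Fintype.card n + (M.trace + star M.trace) +
        ∑ j, ∑ i, ((‖M i j‖ ^ 2 : ℝ) : ℂ) := by
      have : P = 1 + (M + M.conjTranspose) + M.conjTranspose * M := by
        rw [hPdef, Matrix.conjTranspose_add, Matrix.conjTranspose_one]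
        noncomm_ring
      rw [this, Matrix.trace_add, Matrix.trace_add, Matrix.trace_add, Matrix.trace_one,
        Matrix.trace_conjTranspose]
      congr 1
      simp only [Matrix.trace, Matrix.diag_apply, Matrix.mul_apply, Matrix.conjTranspose_apply]
      refine Finset.sum_congr rfl fun j _ => Finset.sum_congr rfl fun i _ => ?_
      rw [← starRingEnd_apply, Complex.conj_mul']
      push_cast
      rfl
    rw [h2] at h
    simp only [Complex.add_re, Complex.natCast_re, Complex.re_sum, Complex.star_def,
      Complex.conj_re] at h
    have h3 : ∀ x : ℝ, ((x : ℂ)).re = x := Complex.ofReal_re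
    rw [Finset.sum_comm (f := fun i j => ‖M i j‖ ^ 2)]
    simp only [h3] at h
    refine Eq.trans ?_ (h.symm.trans ?_)
    · simp
    · ring
  have hle : ∏ i, hP.1.eigenvalues i ≤ ∏ i, Real.exp (hP.1.eigenvalues i - 1) :=
    Finset.prod_le_prod (fun i _ => hP.eigenvalues_nonneg i) fun i _ => by
      linarith [Real.add_one_le_exp (hP.1.eigenvalues i - 1)]
  have hdet' : ‖(1 + M).det‖ ^ 2 = ∏ i, hP.1.eigenvalues i := by exact_mod_cast hdet
  rw [hdet']
  refine hle.trans (le_of_eq ?_)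
  rw [← Real.exp_sum, Finset.sum_sub_distrib, htr]
  simp

/-! ### Existence and basis independence of the trace and the Fredholm determinant. -/

section Limits

variable {H : Type u} [NormedAddCommGroup H] [InnerProductSpace ℂ H] [CompleteSpace H]

/-- The trace of the section is bounded by `20c`. By Bessel, its squared Hilbert–Schmidt norm is at
most a diagonal sum of `T*T`, hence at most `20c²`. The exponent is half of `2 · 20c + 20c²`. -/
theorem sectionDet_norm_le {ι : Type u} (b : HilbertBasis ι ℂ H) (s : Finset ι) {T : H →L[ℂ] H}
    {c : ℝ} (hc : 0 ≤ c) (hT : schattenSum 1 T ≤ ENNReal.ofReal c) :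
    ‖sectionDet b T s‖ ≤ Real.exp (20 * c + 10 * c ^ 2) := by
  classical
  have hb := b.orthonormal
  have hnorm : ‖T‖ₑ ≤ ENNReal.ofReal c := by
    simpa using (enorm_rpow_le_schattenSum 1 T).trans hT
  have hTT : schattenSum 1 (ContinuousLinearMap.adjoint T * T) ≤ ENNReal.ofReal (c * c) := by
    refine (schattenSum_mul_le_left _ _ zero_le_one).trans ?_
    rw [ENNReal.rpow_one, ENNReal.ofReal_mul hc]
    gcongr
    rwa [← ofReal_norm, LinearIsometryEquiv.norm_map, ofReal_norm]
  have htr : (Matrix.of fun i j : s => inner ℂ (b i) (T (b j))).trace.re ≤ 20 * c := by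
    refine (Complex.re_le_norm _).trans ((norm_sum_le _ _).trans ?_)
    refine le_trans (le_of_eq ?_) (sum_norm_inner_apply_le hb s hc hT)
    exact Finset.sum_coe_sort s fun i => ‖inner ℂ (b i) (T (b i))‖
  have hhs : ∑ i : s, ∑ j : s,
      ‖(Matrix.of fun i j : s => inner ℂ (b i) (T (b j))) i j‖ ^ 2 ≤ 20 * (c * c) := by
    rw [Finset.sum_comm]
    refine le_trans ?_ (sum_norm_inner_apply_le hb s (mul_nonneg hc hc) hTT)
    rw [← Finset.sum_coe_sort s]
    refine Finset.sum_le_sum fun j _ => ?_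
    have h1 : ‖inner ℂ (b j) ((ContinuousLinearMap.adjoint T * T) (b j))‖ = ‖T (b j)‖ ^ 2 := by
      rw [mul_apply_eq_comp, ContinuousLinearMap.adjoint_inner_right,
        inner_self_eq_norm_sq_to_K]
      simp
    rw [h1]
    refine le_trans (le_of_eq ?_) (hb.sum_inner_products_le (T (b j)) (s := s))
    exact Finset.sum_coe_sort s fun i => ‖inner ℂ (b i) (T (b j))‖ ^ 2
  have h := Matrix.norm_det_one_add_sq_le (Matrix.of fun i j : s => inner ℂ (b i) (T (b j)))
  have h2 : ‖sectionDet b T s‖ ^ 2 ≤ Real.exp (20 * c + 10 * c ^ 2) ^ 2 := by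
    refine (h.trans (Real.exp_le_exp.2 (add_le_add (mul_le_mul_of_nonneg_left htr zero_le_two)
      hhs))).trans_eq ?_
    rw [← Real.exp_nat_mul]
    congr 1
    push_cast
    ring
  exact le_of_sq_le_sq h2 (Real.exp_pos _).le

/-- Schwarz lemma: the section determinant of `T + zW` is entire in `z` and bounded on the disc of
radius `ε⁻¹`, where `zW` has trace class size at most `1`. Comparing `z = 1` with `z = 0` gains the
factor `ε`. The `4(c + 1)` is the quasi-triangle constant times `c + 1`. -/
theorem sectionDet_sub_norm_le {ι : Type u} (b : HilbertBasis ι ℂ H) (s : Finset ι)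
    {T W : H →L[ℂ] H} {c ε : ℝ} (hc : 0 ≤ c) (hT : schattenSum 1 T ≤ ENNReal.ofReal c)
    (hε : 0 < ε) (hε1 : ε < 1) (hW : schattenSum 1 W ≤ ENNReal.ofReal ε) :
    ‖sectionDet b (T + W) s - sectionDet b T s‖ ≤
      2 * Real.exp (20 * (4 * (c + 1)) + 10 * (4 * (c + 1)) ^ 2) * ε := by
  classical
  set M := Real.exp (20 * (4 * (c + 1)) + 10 * (4 * (c + 1)) ^ 2) with hM
  set f : ℂ → ℂ := fun z => sectionDet b (T + z • W) s with hf
  have hdiff : Differentiable ℂ f := by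
    simp only [hf, sectionDet, Matrix.det_apply, _root_.add_apply, _root_.smul_apply,
      inner_add_right, inner_smul_right, Matrix.add_apply, Matrix.of_apply]
    fun_prop
  have hbd : ∀ z ∈ Metric.ball (0 : ℂ) ε⁻¹, ‖f z‖ ≤ M := by
    intro z hz
    refine sectionDet_norm_le b s (by positivity) ?_
    refine (schattenSum_add_le _ _ zero_le_one).trans ?_
    have h1 : schattenSum 1 (z • W) ≤ ENNReal.ofReal 1 := by
      refine (schattenSum_smul_le _ _ zero_le_one).trans ?_
      rw [ENNReal.rpow_one, ← ofReal_norm]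
      refine (mul_le_mul_right hW _).trans ?_
      rw [← ENNReal.ofReal_mul (norm_nonneg z)]
      refine ENNReal.ofReal_le_ofReal ?_
      have : ‖z‖ ≤ ε⁻¹ := by simpa using (Metric.mem_ball.1 hz).le
      calc ‖z‖ * ε ≤ ε⁻¹ * ε := by gcongr
        _ = 1 := inv_mul_cancel₀ hε.ne'
    calc _ ≤ 2 * 2 ^ (1 : ℝ) * (ENNReal.ofReal c + ENNReal.ofReal 1) := by gcongr
      _ = _ := by
        rw [ENNReal.rpow_one, ENNReal.ofReal_mul (by norm_num), ENNReal.ofReal_add hc zero_le_one,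
          ENNReal.ofReal_ofNat]
        norm_num
  have h0 : (0 : ℂ) ∈ Metric.ball (0 : ℂ) ε⁻¹ := Metric.mem_ball_self (inv_pos.2 hε)
  have h1 : (1 : ℂ) ∈ Metric.ball (0 : ℂ) ε⁻¹ := by
    simpa using (one_lt_inv₀ hε).2 hε1
  have h := Complex.dist_le_div_mul_dist_of_mapsTo_ball (R₂ := 2 * M) hdiff.differentiableOn
    (fun z hz => by
      rw [Metric.mem_closedBall, dist_eq_norm]
      linarith [norm_sub_le (f z) (f 0), hbd z hz, hbd 0 h0]) h1
  simpa [hf, dist_eq_norm] using h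

/-- The approximation is uniform in the basis and in the section, and for finite rank the limit is
the same in all bases. So a limit found in one reference basis transfers to every other. -/
theorem exists_tendsto_of_finiteRank_approx
    (Φ : ∀ {ι : Type u}, HilbertBasis ι ℂ H → Finset ι → (H →L[ℂ] H) → ℂ) (T : H →L[ℂ] H)
    (hfin : ∀ (n : ℕ) (F : H →L[ℂ] H), (F : H →ₗ[ℂ] H).rank ≤ (n : Cardinal.{u}) →
      ∃ e, ∀ (ι : Type u) (b : HilbertBasis ι ℂ H), Tendsto (fun s => Φ b s F) atTop (𝓝 e))
    (happ : ∀ ε : ℝ, 0 < ε → ∃ (n : ℕ) (F : H →L[ℂ] H), (F : H →ₗ[ℂ] H).rank ≤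
      (n : Cardinal.{u}) ∧ ∀ (ι : Type u) (b : HilbertBasis ι ℂ H) (s : Finset ι),
        ‖Φ b s T - Φ b s F‖ ≤ ε) :
    ∃ d, ∀ (ι : Type u) (b : HilbertBasis ι ℂ H), Tendsto (fun s => Φ b s T) atTop (𝓝 d) := by
  classical
  obtain ⟨w, b₀, -⟩ := exists_hilbertBasis ℂ H
  have hc : CauchySeq fun s => Φ b₀ s T := by
    refine Metric.cauchySeq_iff'.2 fun ε hε => ?_
    obtain ⟨n, F, hF, h⟩ := happ (ε / 5) (by positivity)
    obtain ⟨e, he⟩ := hfin n F hF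
    obtain ⟨s₀, hs₀⟩ := Metric.tendsto_atTop.1 (he _ b₀) (ε / 5) (by positivity)
    refine ⟨s₀, fun s hs => ?_⟩
    have h1 := h _ b₀ s
    have h2 := h _ b₀ s₀
    have h3 := hs₀ s hs
    have h4 := hs₀ s₀ le_rfl
    rw [← dist_eq_norm] at h1 h2
    rw [dist_comm] at h2 h4
    linarith [dist_triangle4 (Φ b₀ s T) (Φ b₀ s F) (Φ b₀ s₀ F) (Φ b₀ s₀ T),
      dist_triangle (Φ b₀ s F) e (Φ b₀ s₀ F), dist_comm (Φ b₀ s₀ F) (Φ b₀ s₀ T)]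
  obtain ⟨d, hd⟩ := cauchySeq_tendsto_of_complete hc
  refine ⟨d, fun ι b => Metric.tendsto_atTop.2 fun ε hε => ?_⟩
  obtain ⟨n, F, hF, h⟩ := happ (ε / 5) (by positivity)
  obtain ⟨e, he⟩ := hfin n F hF
  have hed : ‖d - e‖ ≤ ε / 5 :=
    le_of_tendsto (hd.sub (he _ b₀)).norm (Eventually.of_forall fun s => h _ b₀ s)
  obtain ⟨s₀, hs₀⟩ := Metric.tendsto_atTop.1 (he _ b) (ε / 5) (by positivity)
  refine ⟨s₀, fun s hs => ?_⟩
  have h1 := h _ b s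
  have h3 := hs₀ s hs
  rw [← dist_eq_norm] at h1 hed
  linarith [dist_triangle4 (Φ b s T) (Φ b s F) e d, dist_comm d e]

theorem exists_hasTrace_of_rank_le {n : ℕ} {F : H →L[ℂ] H}
    (hF : (F : H →ₗ[ℂ] H).rank ≤ (n : Cardinal.{u})) : ∃ t, HasTrace F t := by
  obtain ⟨r, -, u, v, -, -, h⟩ := exists_sum_inner_smul_of_rank_le hF
  refine ⟨∑ j, inner ℂ (v j) (u j), fun ι b => ?_⟩
  simp only [h, inner_sum, inner_smul_right]
  exact hasSum_sum fun j _ => b.hasSum_inner_mul_inner (v j) (u j)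

/-- The identity `det(1 + UV) = det(1 + VU)` turns the growing section into a matrix of fixed size
whose entries are partial sums of Parseval's identity. -/
theorem exists_hasFredholmDet_of_rank_le {n : ℕ} {F : H →L[ℂ] H}
    (hF : (F : H →ₗ[ℂ] H).rank ≤ (n : Cardinal.{u})) : ∃ d, HasFredholmDet F d := by
  classical
  obtain ⟨r, -, u, v, -, -, h⟩ := exists_sum_inner_smul_of_rank_le hF
  refine ⟨Matrix.det (1 + Matrix.of fun j l => inner ℂ (v j) (u l)), fun ι b => ?_⟩
  have hs : ∀ s : Finset ι, sectionDet b F s =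
      Matrix.det (1 + Matrix.of fun j l => ∑ i ∈ s, inner ℂ (v j) (b i) * inner ℂ (b i) (u l)) := by
    intro s
    let U : Matrix s (Fin r) ℂ := Matrix.of fun i l => inner ℂ (b i) (u l)
    let V : Matrix (Fin r) s ℂ := Matrix.of fun j i => inner ℂ (v j) (b i)
    have h1 : (Matrix.of fun i j : s => inner ℂ (b i) (F (b j))) = U * V := by
      ext i j
      simp only [U, V, Matrix.mul_apply, Matrix.of_apply, h, inner_sum, inner_smul_right]
      exact Finset.sum_congr rfl fun _ _ => mul_comm _ _
    have h2 : (Matrix.of fun j l => ∑ i ∈ s, inner ℂ (v j) (b i) * inner ℂ (b i) (u l)) =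
        V * U := by
      ext j l
      simp only [U, V, Matrix.mul_apply, Matrix.of_apply]
      exact (Finset.sum_coe_sort s fun i => inner ℂ (v j) (b i) * inner ℂ (b i) (u l)).symm
    rw [h2, ← Matrix.det_one_add_mul_comm, ← h1, sectionDet]
  rw [tendsto_congr hs]
  refine ((continuous_id.matrix_det).tendsto _).comp (tendsto_const_nhds.add ?_)
  refine tendsto_pi_nhds.2 fun j => tendsto_pi_nhds.2 fun l => ?_
  exact b.hasSum_inner_mul_inner (v j) (u l)

theorem exists_hasTrace {T : H →L[ℂ] H} (hT : schattenSum 1 T ≠ ∞) : ∃ t, HasTrace T t := by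
  refine exists_tendsto_of_finiteRank_approx
    (fun b s T => ∑ i ∈ s, inner ℂ (b i) (T (b i))) T
    (fun n F hF => exists_hasTrace_of_rank_le hF) fun ε hε => ?_
  obtain ⟨n, F, hF, h⟩ := exists_rank_le_schattenSum_sub_le one_pos hT
    (ENNReal.ofReal_pos.2 (show 0 < ε / 20 by positivity)).ne'
  refine ⟨n, F, hF, fun ι b s => ?_⟩
  have h1 := sum_norm_inner_apply_le b.orthonormal s (by positivity) h
  rw [← Finset.sum_sub_distrib]
  refine (norm_sum_le _ _).trans ?_
  simp only [_root_.sub_apply, inner_sub_right] at h1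
  linarith

theorem exists_hasFredholmDet {T : H →L[ℂ] H} (hT : schattenSum 1 T ≠ ∞) :
    ∃ d, HasFredholmDet T d := by
  refine exists_tendsto_of_finiteRank_approx (fun b s T => sectionDet b T s) T
    (fun n F hF => exists_hasFredholmDet_of_rank_le hF) fun ε hε => ?_
  set c := (schattenSum 1 T).toReal with hc
  have hTc : schattenSum 1 T ≤ ENNReal.ofReal c := (ENNReal.ofReal_toReal hT).ge
  set M := 2 * Real.exp (20 * (4 * (c + 1)) + 10 * (4 * (c + 1)) ^ 2) with hM
  have hM0 : 0 < M := by positivity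
  set δ := min (1 / 2) (ε / M) with hδ
  have hδ0 : 0 < δ := lt_min (by norm_num) (by positivity)
  obtain ⟨n, F, hF, h⟩ := exists_rank_le_schattenSum_sub_le one_pos hT
    (ENNReal.ofReal_pos.2 hδ0).ne'
  refine ⟨n, F, hF, fun ι b s => ?_⟩
  have h1 := sectionDet_sub_norm_le b s ENNReal.toReal_nonneg hTc hδ0
    ((min_le_left _ _).trans_lt (by norm_num)) ((schattenSum_neg_le (T - F) zero_le_one).trans h)
  rw [neg_sub, add_sub_cancel, norm_sub_rev] at h1
  refine h1.trans ?_
  calc M * δ ≤ M * (ε / M) := by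
        gcongr
        exact min_le_right _ _
    _ = ε := by field_simp

end Limits

/-! ### Limits in which the operator varies together with the section. -/

section SectionLimits

variable {H : Type u} [NormedAddCommGroup H] [InnerProductSpace ℂ H] [CompleteSpace H]
  {ι : Type u} {T : Finset ι → H →L[ℂ] H} {T₀ : H →L[ℂ] H}

theorem SchattenTendsto.tendsto_sectionDet (hT : SchattenTendsto 1 atTop T T₀) {d : ℂ}
    (hd : HasFredholmDet T₀ d) (b : HilbertBasis ι ℂ H) :
    Tendsto (fun s => sectionDet b (T s) s) atTop (𝓝 d) := by
  set c := (schattenSum 1 T₀).toReal with hc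
  have hTc : schattenSum 1 T₀ ≤ ENNReal.ofReal c := (ENNReal.ofReal_toReal hT.1).ge
  set M := 2 * Real.exp (20 * (4 * (c + 1)) + 10 * (4 * (c + 1)) ^ 2) with hM
  have hM0 : 0 < M := by positivity
  have h0 : Tendsto (fun s => sectionDet b (T s) s - sectionDet b T₀ s) atTop (𝓝 0) := by
    refine Metric.tendsto_nhds.2 fun ε hε => ?_
    set δ := min (1 / 2) (ε / 2 / M) with hδ
    have hδ0 : 0 < δ := lt_min (by norm_num) (by positivity)
    filter_upwards [hT.2.eventually_le_const (ENNReal.ofReal_pos.2 hδ0)] with s hs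
    have h1 := sectionDet_sub_norm_le b s ENNReal.toReal_nonneg hTc hδ0
      ((min_le_left _ _).trans_lt (by norm_num)) hs
    rw [add_sub_cancel] at h1
    rw [dist_zero_right]
    calc _ ≤ M * δ := h1
      _ ≤ M * (ε / 2 / M) := by
        gcongr
        exact min_le_right _ _
      _ = ε / 2 := by field_simp
      _ < ε := half_lt_self hε
  simpa using h0.add (hd ι b)

theorem SchattenTendsto.tendsto_sum_inner (hT : SchattenTendsto 1 atTop T T₀) {t : ℂ}
    (ht : HasTrace T₀ t) (b : HilbertBasis ι ℂ H) :
    Tendsto (fun s => ∑ i ∈ s, inner ℂ (b i) (T s (b i))) atTop (𝓝 t) := by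
  have h0 : Tendsto (fun s => ∑ i ∈ s, inner ℂ (b i) ((T s - T₀) (b i))) atTop (𝓝 0) := by
    refine Metric.tendsto_nhds.2 fun ε hε => ?_
    have hδ0 : 0 < ε / 40 := by positivity
    filter_upwards [hT.2.eventually_le_const (ENNReal.ofReal_pos.2 hδ0)] with s hs
    rw [dist_zero_right]
    have := sum_norm_inner_apply_le b.orthonormal s hδ0.le hs
    exact (norm_sum_le _ _).trans_lt (by linarith)
  have h := h0.add (ht ι b)
  rw [zero_add] at h
  refine h.congr fun s => ?_
  rw [← Finset.sum_add_distrib]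
  refine Finset.sum_congr rfl fun i _ => ?_
  rw [_root_.sub_apply, inner_sub_right, sub_add_cancel]

end SectionLimits

/-! ### Factorization `R_p(T) = T^p G(T)` with continuous `G`. -/

section RegularizedFactor

variable {𝔸 : Type*} [NormedRing 𝔸] [NormedAlgebra ℂ 𝔸] [CompleteSpace 𝔸]

theorem hasDerivAt_exp_sum_smul_pow (T : 𝔸) (c : ℕ → ℂ) (m : ℕ) (z : ℂ) :
    HasDerivAt (fun z : ℂ => NormedSpace.exp (∑ j ∈ Finset.Icc 1 m, (c j * z ^ j) • T ^ j))
      ((∑ j ∈ Finset.Icc 1 m, (c j * (j * z ^ (j - 1))) • T ^ j) *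
        NormedSpace.exp (∑ j ∈ Finset.Icc 1 m, (c j * z ^ j) • T ^ j)) z := by
  let _ : NormedAlgebra ℚ 𝔸 := NormedAlgebra.restrictScalars ℚ ℂ 𝔸
  induction m with
  | zero => simpa using hasDerivAt_const z (1 : 𝔸)
  | succ m ih =>
    have hcomm : ∀ z : ℂ, Commute (∑ j ∈ Finset.Icc 1 m, (c j * z ^ j) • T ^ j)
        ((c (m + 1) * z ^ (m + 1)) • T ^ (m + 1)) := fun z =>
      (Commute.sum_left _ _ _ fun j _ =>
        ((Commute.pow_pow_self T j (m + 1)).smul_left _)).smul_right _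
    have hcomm' : Commute (∑ j ∈ Finset.Icc 1 m, (c j * z ^ j) • T ^ j) (T ^ (m + 1)) :=
      Commute.sum_left _ _ _ fun j _ => ((Commute.pow_pow_self T j (m + 1)).smul_left _)
    have h1 : HasDerivAt (fun z : ℂ => c (m + 1) * z ^ (m + 1))
        (c (m + 1) * ((m + 1 : ℕ) * z ^ (m + 1 - 1))) z :=
      (hasDerivAt_pow (m + 1) z).const_mul _
    have h2 := (hasDerivAt_exp_smul_const (T ^ (m + 1)) (c (m + 1) * z ^ (m + 1))).scomp z h1
    have h3 := ih.mul h2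
    simp only [Finset.sum_Icc_succ_top (Nat.le_add_left 1 m)]
    have hfun : (fun z : ℂ => NormedSpace.exp (∑ j ∈ Finset.Icc 1 m, (c j * z ^ j) • T ^ j +
        (c (m + 1) * z ^ (m + 1)) • T ^ (m + 1))) = fun z : ℂ =>
        NormedSpace.exp (∑ j ∈ Finset.Icc 1 m, (c j * z ^ j) • T ^ j) *
          NormedSpace.exp ((c (m + 1) * z ^ (m + 1)) • T ^ (m + 1)) :=
      funext fun z => NormedSpace.exp_add_of_commute (hcomm z)
    rw [hfun, NormedSpace.exp_add_of_commute (hcomm z)]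
    refine h3.congr_deriv ?_
    have hc1 : Commute (NormedSpace.exp (∑ j ∈ Finset.Icc 1 m, (c j * z ^ j) • T ^ j))
        (T ^ (m + 1)) := hcomm'.exp_left
    have hc2 : Commute (NormedSpace.exp ((c (m + 1) * z ^ (m + 1)) • T ^ (m + 1)))
        (T ^ (m + 1)) := ((Commute.refl _).smul_left _).exp_left
    simp only [Function.comp_apply]
    rw [hc2.eq, mul_smul_comm, ← mul_assoc (NormedSpace.exp _) (T ^ (m + 1)), hc1.eq, add_mul, smul_mul_assoc, mul_assoc, mul_assoc]

/-- The sum telescopes. The left side is the derivative of `(1 + zT) exp(Q z)` stripped of its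
exponential, `Q` being the truncated series for `-log(1 + zT)`. -/
theorem add_one_add_smul_mul_sum {𝔸 : Type*} [Ring 𝔸] [Algebra ℂ 𝔸] (T : 𝔸) (z : ℂ) (m : ℕ) :
    T + (1 + z • T) * ∑ j ∈ Finset.Icc 1 m, ((-1) ^ j * z ^ (j - 1)) • T ^ j =
      ((-1) ^ m * z ^ m) • T ^ (m + 1) := by
  induction m with
  | zero => simp
  | succ m ih =>
    rw [Finset.sum_Icc_succ_top (Nat.le_add_left 1 m), mul_add, ← add_assoc, ih,
      Nat.add_sub_cancel, add_mul, one_mul, smul_mul_smul_comm, ← pow_succ', ← add_assoc,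
      ← add_smul]
    have : (-1 : ℂ) ^ m * z ^ m + (-1) ^ (m + 1) * z ^ m = 0 := by ring
    rw [this, zero_smul, zero_add]
    congr 1
    ring

/-- The factor `G` in `(1 + T) exp (∑_{1 ≤ j < p} (-1)^j j⁻¹ T^j) - 1 = T ^ p * G T`. -/
noncomputable def regFactor (p : ℕ) (T : 𝔸) : 𝔸 :=
  ∫ t in (0 : ℝ)..1, ((-1 : ℂ) ^ (p - 1) * (t : ℂ) ^ (p - 1)) • NormedSpace.exp
    (∑ j ∈ Finset.Icc 1 (p - 1), ((-1 : ℂ) ^ j * (j : ℂ)⁻¹ * (t : ℂ) ^ j) • T ^ j)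

theorem continuous_regFactor_integrand (p : ℕ) :
    Continuous (fun x : 𝔸 × ℝ => ((-1 : ℂ) ^ (p - 1) * (x.2 : ℂ) ^ (p - 1)) • NormedSpace.exp
      (∑ j ∈ Finset.Icc 1 (p - 1), ((-1 : ℂ) ^ j * (j : ℂ)⁻¹ * (x.2 : ℂ) ^ j) • x.1 ^ j)) := by
  let _ : NormedAlgebra ℚ 𝔸 := NormedAlgebra.restrictScalars ℚ ℂ 𝔸
  refine Continuous.smul (by fun_prop) (NormedSpace.exp_continuous.comp ?_)
  fun_prop

theorem continuous_regFactor (p : ℕ) : Continuous (regFactor p : 𝔸 → 𝔸) :=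
  intervalIntegral.continuous_parametric_intervalIntegral_of_continuous'
    (f := fun (T : 𝔸) (t : ℝ) => ((-1 : ℂ) ^ (p - 1) * (t : ℂ) ^ (p - 1)) • NormedSpace.exp
      (∑ j ∈ Finset.Icc 1 (p - 1), ((-1 : ℂ) ^ j * (j : ℂ)⁻¹ * (t : ℂ) ^ j) • T ^ j))
    (continuous_regFactor_integrand p) 0 1

/-- Integrate the derivative of `(1 + tT) exp(Q t)` over `[0, 1]`: the value at `0` is `1`, and the
derivative is `T^p` times the integrand of `regFactor`. -/
theorem one_add_mul_exp_sub_one_eq {p : ℕ} (hp : 1 ≤ p) (T : 𝔸) :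
    (1 + T) * NormedSpace.exp (∑ j ∈ Finset.Icc 1 (p - 1), ((-1 : ℂ) ^ j * (j : ℂ)⁻¹) • T ^ j) -
      1 = T ^ p * regFactor p T := by
  obtain ⟨m, rfl⟩ := Nat.exists_eq_add_of_le' hp
  simp only [regFactor, Nat.add_sub_cancel]
  set Q : ℂ → 𝔸 := fun z => ∑ j ∈ Finset.Icc 1 m, ((-1 : ℂ) ^ j * (j : ℂ)⁻¹ * z ^ j) • T ^ j
    with hQ
  have hQd : ∀ z, HasDerivAt (fun z => NormedSpace.exp (Q z))
      ((∑ j ∈ Finset.Icc 1 m, ((-1) ^ j * z ^ (j - 1)) • T ^ j) * NormedSpace.exp (Q z)) z := by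
    intro z
    refine (hasDerivAt_exp_sum_smul_pow T (fun j => (-1 : ℂ) ^ j * (j : ℂ)⁻¹) m z).congr_deriv ?_
    congr 1
    refine Finset.sum_congr rfl fun j hj => ?_
    have : (j : ℂ) ≠ 0 := by
      have := (Finset.mem_Icc.1 hj).1
      exact_mod_cast (by omega : j ≠ 0)
    congr 1
    field_simp
  have hE : ∀ z : ℂ, HasDerivAt (fun z : ℂ => (1 + z • T) * NormedSpace.exp (Q z))
      (T ^ (m + 1) * (((-1 : ℂ) ^ m * z ^ m) • NormedSpace.exp (Q z))) z := by
    intro z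
    have h1 : HasDerivAt (fun z : ℂ => 1 + z • T) T z := by
      simpa using ((hasDerivAt_id z).smul_const T).const_add 1
    refine (h1.mul (hQd z)).congr_deriv ?_
    rw [← mul_assoc, ← add_mul, add_one_add_smul_mul_sum, smul_mul_assoc, mul_smul_comm]
  have hcont : Continuous fun t : ℝ =>
      ((-1 : ℂ) ^ m * (t : ℂ) ^ m) • NormedSpace.exp (Q t) :=
    (continuous_regFactor_integrand (𝔸 := 𝔸) (m + 1)).comp
      (Continuous.prodMk continuous_const continuous_id : Continuous fun t : ℝ => (T, t))
  have hE' : ∀ t : ℝ, HasDerivAt (fun t : ℝ => (1 + (t : ℂ) • T) * NormedSpace.exp (Q t))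
      (T ^ (m + 1) * (((-1 : ℂ) ^ m * (t : ℂ) ^ m) • NormedSpace.exp (Q t))) t := fun t =>
    ((hE t).scomp t (Complex.ofRealCLM.hasDerivAt (x := t))).congr_deriv (by simp)
  have hftc := intervalIntegral.integral_eq_sub_of_hasDerivAt (a := 0) (b := 1)
    (f := fun t : ℝ => (1 + (t : ℂ) • T) * NormedSpace.exp (Q t))
    (fun t _ => hE' t) ((continuous_const.mul hcont).intervalIntegrable 0 1)
  have hpull := ((ContinuousLinearMap.mul ℝ 𝔸) (T ^ (m + 1))).intervalIntegral_comp_comm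
    (hcont.intervalIntegrable (μ := MeasureTheory.volume) 0 1)
  simp only [ContinuousLinearMap.mul_apply'] at hpull
  rw [← hpull, hftc]
  have hQ0 : Q 0 = 0 := Finset.sum_eq_zero fun j hj => by
    have := (Finset.mem_Icc.1 hj).1
    rw [zero_pow (by omega), mul_zero, zero_smul]
  have hQ1 : Q 1 = ∑ j ∈ Finset.Icc 1 m, ((-1 : ℂ) ^ j * (j : ℂ)⁻¹) • T ^ j := by
    simp [hQ]
  simp [hQ0, hQ1]

end RegularizedFactor

section

variable {H : Type u} [NormedAddCommGroup H] [InnerProductSpace ℂ H] [CompleteSpace H]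
  {α : Type*} {l : Filter α} {T : α → H →L[ℂ] H} {T₀ : H →L[ℂ] H}

theorem SchattenTendsto.regR {p : ℕ} (hp : 1 ≤ p) (hT : SchattenTendsto p l T T₀) :
    SchattenTendsto 1 l (fun s => regR p (T s)) (regR p T₀) := by
  have hpow := SchattenTendsto.list_prod_of_le_length (W := fun _ : Unit => T)
    (W₀ := fun _ : Unit => T₀) hp (fun _ => hT) (List.replicate p ()) (by simp)
  simp only [List.map_replicate, List.prod_replicate] at hpow
  have hG := ((continuous_regFactor p).tendsto T₀).comp
    (hT.tendsto (by exact_mod_cast hp : (0 : ℝ) < p))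
  simpa only [_root_.regR, one_add_mul_exp_sub_one_eq hp, Function.comp_def] using hpow.mul_of_tendsto one_pos hG

end

/-! ### Determinant of a matrix exponential. -/

section MatrixExp

variable {n : Type*} [Fintype n] [DecidableEq n]

/-- In the Leibniz formula a permutation other than the identity moves both some `j` and `σ j`. With
one factor differentiated, an off-diagonal entry of the identity matrix is still left, so only the
identity permutation contributes. -/
theorem Matrix.hasDerivAt_det_of_eq_one {p : ℂ → Matrix n n ℂ} {M : Matrix n n ℂ} {z : ℂ}
    (hp : ∀ i j, HasDerivAt (fun z => p z i j) (M i j) z) (h1 : p z = 1) :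
    HasDerivAt (fun z => (p z).det) M.trace z := by
  have h : HasDerivAt (fun z => ∑ σ : Equiv.Perm n, (Equiv.Perm.sign σ : ℂ) * ∏ i, p z (σ i) i)
      (∑ σ : Equiv.Perm n, (Equiv.Perm.sign σ : ℂ) *
        ∑ i, (∏ j ∈ Finset.univ.erase i, p z (σ j) j) • M (σ i) i) z :=
    HasDerivAt.fun_sum fun σ _ =>
      (HasDerivAt.fun_finsetProd fun i _ => hp (σ i) i).const_mul _
  simp only [← Matrix.det_apply'] at h
  refine h.congr_deriv ?_
  rw [Finset.sum_eq_single (1 : Equiv.Perm n), Matrix.trace]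
  · simp [h1]
  · intro σ _ hσ
    obtain ⟨j, hj⟩ : ∃ j, σ j ≠ j := by
      by_contra! hc
      exact hσ (Equiv.ext hc)
    have hj' : σ (σ j) ≠ σ j := fun hc => hj (σ.injective hc)
    refine mul_eq_zero_of_right _ (Finset.sum_eq_zero fun i _ => ?_)
    suffices h0 : ∏ j ∈ Finset.univ.erase i, (1 : Matrix n n ℂ) (σ j) j = 0 by
      rw [h1]
      exact (congrArg (· • M (σ i) i) h0).trans (zero_smul _ _)
    rcases eq_or_ne i j with rfl | hij
    · exact Finset.prod_eq_zero (Finset.mem_erase.2 ⟨hj, Finset.mem_univ _⟩)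
        (Matrix.one_apply_ne hj')
    · exact Finset.prod_eq_zero (Finset.mem_erase.2 ⟨hij.symm, Finset.mem_univ _⟩)
        (Matrix.one_apply_ne hj)
  · simp

open scoped Matrix.Norms.Operator in
theorem Matrix.hasDerivAt_exp_smul_entry (M : Matrix n n ℂ) (i j : n) :
    HasDerivAt (fun z : ℂ => NormedSpace.exp (z • M) i j) (M i j) 0 := by
  have h := hasDerivAt_exp_smul_const M (0 : ℂ)
  have h2 := ((Matrix.entryLinearMap ℂ ℂ i j).toContinuousLinearMap).hasFDerivAt.comp_hasDerivAt
    (0 : ℂ) h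
  refine h2.congr_deriv ?_
  change (NormedSpace.exp ((0 : ℂ) • M) * M) i j = M i j
  rw [zero_smul, NormedSpace.exp_zero, one_mul]

/-- `z ↦ det(exp(zM))` turns sums into products and has derivative `tr M` at `0`, hence solves `f' =
f · tr M` with `f 0 = 1`. -/
theorem Matrix.det_exp_eq_exp_trace (M : Matrix n n ℂ) :
    (NormedSpace.exp M).det = Complex.exp M.trace := by
  set f : ℂ → ℂ := fun z => (NormedSpace.exp (z • M)).det with hf
  have hadd : ∀ z w, f (z + w) = f z * f w := fun z w => by
    simp only [hf]
    rw [add_smul, Matrix.exp_add_of_commute _ _ (((Commute.refl M).smul_left z).smul_right w),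
      Matrix.det_mul]
  have hd0 : HasDerivAt f M.trace 0 :=
    Matrix.hasDerivAt_det_of_eq_one (Matrix.hasDerivAt_exp_smul_entry M) (by simp)
  have hd : ∀ z, HasDerivAt f (f z * M.trace) z := fun z => by
    have h1 : HasDerivAt (fun w => f z * f (w - z)) (f z * M.trace) z := by
      refine HasDerivAt.const_mul _ ?_
      have h2 : HasDerivAt f M.trace (z - z) := by rwa [sub_self]
      exact h2.comp_sub_const z z
    refine h1.congr_of_eventuallyEq (Eventually.of_forall fun w => ?_)
    change f w = f z * f (w - z)
    rw [← hadd, add_sub_cancel]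
  have hg : ∀ z, HasDerivAt (fun z => f z * Complex.exp (-(z * M.trace))) 0 z := fun z => by
    have h1 : HasDerivAt (fun z : ℂ => -(z * M.trace)) (-(1 * M.trace)) z :=
      ((hasDerivAt_id z).mul_const _).neg
    refine ((hd z).mul h1.cexp).congr_deriv ?_
    ring
  have hconst := is_const_of_deriv_eq_zero (fun z => (hg z).differentiableAt)
    (fun z => (hg z).deriv) 1 0
  have hf0 : f 0 = 1 := by simp [hf]
  have hf1 : f 1 = (NormedSpace.exp M).det := by simp [hf]
  simp only [hf0, hf1, one_mul, zero_mul, neg_zero, Complex.exp_zero, mul_one] at hconst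
  rw [Complex.exp_neg, ← div_eq_mul_inv, div_eq_one_iff_eq (Complex.exp_ne_zero _)] at hconst
  exact hconst

end MatrixExp

/-! ### Compression to finite sections. -/

section Compression

variable {H : Type u} [NormedAddCommGroup H] [InnerProductSpace ℂ H] {ι : Type u}

/-- The orthogonal projection onto the span of the basis vectors `b i`, `i ∈ s`. -/
noncomputable def basisProj (b : HilbertBasis ι ℂ H) (s : Finset ι) : H →L[ℂ] H :=
  ∑ i ∈ s, (innerSL ℂ (b i)).smulRight (b i)

theorem basisProj_apply (b : HilbertBasis ι ℂ H) (s : Finset ι) (x : H) :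
    basisProj b s x = ∑ i ∈ s, inner ℂ (b i) x • b i := by
  simp [basisProj, _root_.sum_apply]

theorem basisProj_apply_basis (b : HilbertBasis ι ℂ H) {s : Finset ι} {j : ι} (hj : j ∈ s) :
    basisProj b s (b j) = b j := by
  classical
  rw [basisProj_apply, Finset.sum_eq_single_of_mem j hj fun i _ hij => by
    rw [b.orthonormal.2 hij, zero_smul]]
  rw [inner_self_eq_norm_sq_to_K, b.orthonormal.1]
  simp

theorem basisProj_mul_self (b : HilbertBasis ι ℂ H) (s : Finset ι) :
    basisProj b s * basisProj b s = basisProj b s := by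
  ext x
  rw [mul_apply_eq_comp, basisProj_apply b s x, map_sum]
  exact Finset.sum_congr rfl fun i hi => by rw [map_smul, basisProj_apply_basis b hi]

theorem inner_basisProj_left (b : HilbertBasis ι ℂ H) (s : Finset ι) (x y : H) :
    inner ℂ (basisProj b s x) y = inner ℂ x (basisProj b s y) := by
  simp only [basisProj_apply, sum_inner, inner_sum, inner_smul_left, inner_smul_right,
    inner_conj_symm]
  exact Finset.sum_congr rfl fun _ _ => mul_comm _ _

theorem norm_basisProj_le [CompleteSpace H] (b : HilbertBasis ι ℂ H) (s : Finset ι) :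
    ‖basisProj b s‖ ≤ 1 := by
  refine IsStarProjection.norm_le _ ⟨basisProj_mul_self b s, ?_⟩
  rw [IsSelfAdjoint, ContinuousLinearMap.star_eq_adjoint]
  exact ((ContinuousLinearMap.eq_adjoint_iff _ _).2 (inner_basisProj_left b s)).symm

theorem tendsto_basisProj (b : HilbertBasis ι ℂ H) (x : H) :
    Tendsto (fun s => basisProj b s x) atTop (𝓝 x) := by
  simp only [basisProj_apply, ← b.repr_apply_apply]
  exact b.hasSum_repr x

/-- The matrix `(⟪b_i, T b_j⟫)` of the finite section of `T`. -/
noncomputable def compress (b : HilbertBasis ι ℂ H) (s : Finset ι) :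
    (H →L[ℂ] H) →ₗ[ℂ] Matrix s s ℂ where
  toFun T := Matrix.of fun i j => inner ℂ (b i) (T (b j))
  map_add' S T := by ext; simp
  map_smul' c T := by ext; simp

variable (b : HilbertBasis ι ℂ H) (s : Finset ι)

theorem compress_apply (T : H →L[ℂ] H) (i j : s) :
    compress b s T i j = inner ℂ (b i) (T (b j)) := rfl

theorem continuous_compress : Continuous (compress b s) := by
  refine continuous_matrix fun i j => ?_
  simp only [compress_apply]
  fun_prop

open Classical in
theorem compress_one : compress b s 1 = 1 := by
  ext i j
  rw [compress_apply, one_apply_eq_self, orthonormal_iff_ite.1 b.orthonormal, Matrix.one_apply]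
  simp

/-- Commuting with the projection keeps `T b_j` in the span of the chosen basis vectors, so its
basis expansion runs over `s` only. -/
theorem compress_mul {S T : H →L[ℂ] H} (hT : Commute (basisProj b s) T) :
    compress b s (S * T) = compress b s S * compress b s T := by
  ext i j
  have h : T (b j) = ∑ l ∈ s, inner ℂ (b l) (T (b j)) • b l := by
    rw [← basisProj_apply]
    nth_rw 1 [← basisProj_apply_basis b j.2]
    exact congrArg (fun A : H →L[ℂ] H => A (b j)) hT.eq.symm
  rw [compress_apply, mul_apply_eq_comp, h, map_sum, inner_sum, Matrix.mul_apply,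
    ← Finset.sum_coe_sort s]
  refine Finset.sum_congr rfl fun l _ => ?_
  rw [map_smul, inner_smul_right, compress_apply, compress_apply, mul_comm]

open Classical in
theorem compress_list_prod (L : List (H →L[ℂ] H)) (hL : ∀ T ∈ L, Commute (basisProj b s) T) :
    compress b s L.prod = (L.map (compress b s)).prod := by
  induction L with
  | nil => simpa using compress_one b s
  | cons T L ih =>
    have hL' : ∀ T ∈ L, Commute (basisProj b s) T := fun T hT => hL T (List.mem_cons_of_mem _ hT)
    rw [List.prod_cons, compress_mul b s (Commute.list_prod_right _ _ hL'), ih hL', List.map_cons,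
      List.prod_cons]

open Classical in
theorem compress_pow {T : H →L[ℂ] H} (hT : Commute (basisProj b s) T) (m : ℕ) :
    compress b s (T ^ m) = compress b s T ^ m := by
  have := compress_list_prod b s (List.replicate m T) (by
    intro S hS
    rwa [List.eq_of_mem_replicate hS])
  simpa using this

open Classical in
theorem compress_exp [CompleteSpace H] {T : H →L[ℂ] H} (hT : Commute (basisProj b s) T) :
    compress b s (NormedSpace.exp T) = NormedSpace.exp (compress b s T) := by
  have h := (NormedSpace.exp_series_hasSum_exp' (𝕂 := ℂ) T).map (compress b s)
    (continuous_compress b s)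
  have h2 : (compress b s ∘ fun n => ((n.factorial : ℂ)⁻¹) • T ^ n) =
      fun n => ((n.factorial : ℂ)⁻¹) • compress b s T ^ n := by
    funext n
    rw [Function.comp_apply, map_smul, compress_pow b s hT]
  rw [h2] at h
  exact ((congrFun (NormedSpace.exp_eq_tsum ℂ) (compress b s T)).trans h.tsum_eq).symm

open Classical in
theorem sectionDet_eq (T : H →L[ℂ] H) : sectionDet b T s = (compress b s (1 + T)).det := by
  rw [map_add, compress_one]
  rfl

theorem trace_compress (T : H →L[ℂ] H) :
    (compress b s T).trace = ∑ i ∈ s, inner ℂ (b i) (T (b i)) :=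
  Finset.sum_coe_sort s fun i => inner ℂ (b i) (T (b i))

end Compression

/-! ### Noncommutative binomial expansion. -/

section NoncommutativeBinomial

variable {R : Type*} [Ring R]

theorem add_pow_eq_sum_finset (x y : R) (j : ℕ) :
    (x + y) ^ j = ∑ S : Finset (Fin j), (List.ofFn fun m => if m ∈ S then y else x).prod := by
  have hfun : ∀ j : ℕ, (x + y) ^ j =
      ∑ f : Fin j → Bool, (List.ofFn fun m => if f m then y else x).prod := by
    intro j
    induction j with
    | zero => simp
    | succ j ih =>
      rw [← (Fin.consEquiv fun _ => Bool).sum_comp, Fintype.sum_prod_type, pow_succ', ih]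
      simp only [Fin.consEquiv_apply, List.ofFn_succ, Fin.cons_zero, Fin.cons_succ,
        List.prod_cons, Fintype.sum_bool, ← Finset.mul_sum]
      rw [add_comm x y, add_mul]
      simp
  rw [hfun]
  refine (Fintype.sum_bijective (fun (S : Finset (Fin j)) (m : Fin j) => decide (m ∈ S))
    ⟨fun S T h => ?_, fun f => ⟨Finset.univ.filter fun m => f m, ?_⟩⟩ _ _ fun S => ?_).symm
  · ext m
    simpa using congrFun h m
  · funext m
    simp
  · simp

theorem list_prod_map_central {z : R} (hz : ∀ x, Commute z x) (p q : R) (L : List Bool) :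
    (L.map fun c => if c then -(z ^ 2 * q) else z * p).prod =
      z ^ (L.length + L.count true) *
        ((-1) ^ L.count true * (L.map fun c => if c then q else p).prod) := by
  induction L with
  | nil => simp
  | cons c L ih =>
    rw [List.map_cons, List.prod_cons, ih, List.map_cons, List.prod_cons]
    set P := (L.map fun c => if c then q else p).prod
    set e := L.count true
    have h1 : ∀ (x : R) (N : ℕ), x * z ^ N = z ^ N * x := fun x N => ((hz x).pow_left N).eq.symm
    have h2 : ∀ x : R, x * (-1) ^ e = (-1) ^ e * x := fun x =>
      ((Commute.neg_one_left x).pow_left e).eq.symm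
    cases c with
    | true =>
      simp only [if_true, List.count_cons_self, List.length_cons]
      rw [show L.length + 1 + (e + 1) = 2 + (L.length + e) by ring, pow_add z 2, pow_succ (-1 : R)]
      simp only [neg_mul, mul_assoc, mul_neg, one_mul]
      rw [← mul_assoc q, h1, mul_assoc, ← mul_assoc q, h2, mul_assoc]
    | false =>
      simp only [Bool.false_eq_true, if_false, List.length_cons]
      rw [List.count_cons_of_ne (by simp), show L.length + 1 + e = 1 + (L.length + e) by ring,
        pow_add z 1, pow_one]
      simp only [mul_assoc]
      rw [← mul_assoc p, h1, mul_assoc, ← mul_assoc p, h2, mul_assoc]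

theorem count_true_ofFn_mem {j : ℕ} (S : Finset (Fin j)) :
    (List.ofFn fun m => decide (m ∈ S)).count true = S.card := by
  have h := Fin.card_filter_univ_eq_vector_get_eq_count true
    (List.Vector.ofFn fun m => decide (m ∈ S))
  simp only [List.Vector.toList_ofFn, List.Vector.get_ofFn] at h
  rw [← h]
  congr 1
  ext m
  simp

/-- Serves twice: `z = X` shows the degree `j + |S|` of each term of `u^j`, and `z = 1` expands `(a
+ b - ab)^j` into the same terms. -/
theorem sub_pow_eq_sum_finset {z : R} (hz : ∀ x, Commute z x) (p q : R) (j : ℕ) :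
    (z * p - z ^ 2 * q) ^ j = ∑ S : Finset (Fin j), z ^ (j + S.card) *
      ((-1) ^ S.card * (List.ofFn fun m => if m ∈ S then q else p).prod) := by
  rw [sub_eq_add_neg, add_pow_eq_sum_finset]
  refine Finset.sum_congr rfl fun S _ => ?_
  have h := list_prod_map_central hz p q (List.ofFn fun m => decide (m ∈ S))
  rw [count_true_ofFn_mem, List.length_ofFn, List.map_ofFn, List.map_ofFn] at h
  simpa [Function.comp_def] using h

end NoncommutativeBinomial

theorem Finset.sum_Icc_one_eq_sum_range {M : Type*} [AddCommMonoid M] (f : ℕ → M) (m : ℕ) :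
    ∑ j ∈ Finset.Icc 1 m, f j = ∑ i ∈ Finset.range m, f (i + 1) := by
  rw [Finset.range_eq_Ico, Finset.sum_Ico_add' f 0 m 1]
  refine Finset.sum_congr ?_ fun _ _ => rfl
  ext j
  simp only [Finset.mem_Icc, Finset.mem_Ico]
  omega

/-! ### The trace identity, by a logarithmic derivative modulo powers of `X`. -/

section TraceIdentity

open Polynomial

variable {R : Type*} [Ring R]

theorem Polynomial.map_coeff_mul_comm {M : Type*} [AddCommMonoid M] (τ : R →+ M)
    (hτ : ∀ x y, τ (x * y) = τ (y * x)) (n : ℕ) (f g : R[X]) :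
    τ ((f * g).coeff n) = τ ((g * f).coeff n) := by
  rw [coeff_mul, coeff_mul, map_sum, map_sum, ← Finset.Nat.sum_antidiagonal_swap]
  exact Finset.sum_congr rfl fun x _ => hτ _ _

/-- The power rule survives under a trace although `u` and its derivative need not commute. The
extra factor `u ^ i` makes the induction close. -/
theorem Polynomial.map_coeff_derivative_pow {M : Type*} [AddCommMonoid M] (τ : R →+ M)
    (hτ : ∀ x y, τ (x * y) = τ (y * x)) (n : ℕ) (u : R[X]) (j i : ℕ) :
    τ ((derivative (u ^ (j + 1)) * u ^ i).coeff n) =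
      (j + 1) • τ ((u ^ (j + i) * derivative u).coeff n) := by
  induction j generalizing i with
  | zero =>
    rw [zero_add, pow_one, zero_add, one_smul, map_coeff_mul_comm τ hτ]
  | succ j ih =>
    rw [pow_succ u (j + 1), derivative_mul, add_mul, coeff_add, map_add, mul_assoc, ← pow_succ', ih,
      mul_assoc, map_coeff_mul_comm τ hτ n (u ^ (j + 1)), mul_assoc, ← pow_add,
      map_coeff_mul_comm τ hτ n (derivative u), succ_nsmul _ (j + 1),
      show j + (i + 1) = j + 1 + i by ring, add_comm i (j + 1)]

/-- The coefficients of `f` and `g` of degree less than `m` agree. -/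
def Polynomial.EqBelow (m : ℕ) (f g : R[X]) : Prop := ∀ n < m, f.coeff n = g.coeff n

theorem Polynomial.EqBelow.trans {m : ℕ} {f g h : R[X]} (h₁ : EqBelow m f g)
    (h₂ : EqBelow m g h) : EqBelow m f h := fun n hn => (h₁ n hn).trans (h₂ n hn)

theorem Polynomial.EqBelow.symm {m : ℕ} {f g : R[X]} (h : EqBelow m f g) : EqBelow m g f :=
  fun n hn => (h n hn).symm

theorem Polynomial.EqBelow.mul {m : ℕ} {f f' g g' : R[X]} (hf : EqBelow m f f')
    (hg : EqBelow m g g') : EqBelow m (f * g) (f' * g') := by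
  intro n hn
  rw [coeff_mul, coeff_mul]
  refine Finset.sum_congr rfl fun x hx => ?_
  have := Finset.HasAntidiagonal.mem_antidiagonal.1 hx
  rw [hf _ (by omega), hg _ (by omega)]

theorem Polynomial.eqBelow_one_sub_X_pow_mul (m : ℕ) (f : R[X]) : EqBelow m (1 - X ^ m * f) 1 := by
  intro n hn
  rw [coeff_sub, coeff_X_pow_mul', if_neg (by omega), sub_zero]

theorem geomSum_X_mul_C_mul (a : R) (m : ℕ) :
    (∑ i ∈ Finset.range m, (X * C a : R[X]) ^ i) * (1 - X * C a) = 1 - X ^ m * C a ^ m := by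
  have h := geom_sum_mul_neg (X * C a : R[X]) m
  rwa [(show Commute (X : R[X]) (C a) from commute_X (C a)).mul_pow] at h

theorem one_sub_mul_geomSum_X_mul_C (a : R) (m : ℕ) :
    (1 - X * C a) * (∑ i ∈ Finset.range m, (X * C a : R[X]) ^ i) = 1 - X ^ m * C a ^ m := by
  have h := mul_neg_geom_sum (X * C a : R[X]) m
  rwa [(show Commute (X : R[X]) (C a) from commute_X (C a)).mul_pow] at h

theorem coeff_geomSum_X_mul_C_mul_C (a : R) {m n : ℕ} (hn : n < m) :
    ((∑ i ∈ Finset.range m, (X * C a : R[X]) ^ i) * C a).coeff n = a ^ (n + 1) := by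
  have h : ∀ i, (X * C a : R[X]) ^ i = C (a ^ i) * X ^ i := fun i => by
    rw [(show Commute (X : R[X]) (C a) from commute_X (C a)).mul_pow, C_pow, X_pow_mul]
  simp only [h]
  rw [coeff_mul_C, finsetSum_coeff]
  simp only [coeff_C_mul_X_pow]
  rw [Finset.sum_ite_eq, if_pos (Finset.mem_range.2 hn), pow_succ]

/-- Modulo `X^m` the geometric sum inverts `1 - u = αβ`, so it equals `β⁻¹α⁻¹` there, while the
derivative of `u` is `aβ + αb`. In the first term cyclicity brings `β` next to its inverse; in the
second `α` cancels at once. The geometric series of `a` and of `b` remain. -/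
theorem map_coeff_geomSum_mul_derivative {M : Type*} [AddCommGroup M] (τ : R →+ M)
    (hτ : ∀ x y, τ (x * y) = τ (y * x)) (a b : R) {m n : ℕ} (hn : n < m) {u : R[X]}
    (hu : u = X * C (a + b) - X ^ 2 * C (a * b)) :
    τ (((∑ i ∈ Finset.range m, u ^ i) * derivative u).coeff n) =
      τ (a ^ (n + 1)) + τ (b ^ (n + 1)) := by
  set S := ∑ i ∈ Finset.range m, u ^ i with hS
  set α : R[X] := 1 - X * C a with hα
  set β : R[X] := 1 - X * C b with hβ
  set Ga := ∑ i ∈ Finset.range m, (X * C a : R[X]) ^ i with hGa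
  set Gb := ∑ i ∈ Finset.range m, (X * C b : R[X]) ^ i with hGb
  have hX : ∀ f : R[X], f * X = X * f := fun f => (X_mul (p := f)).symm
  have hαβ : 1 - u = α * β := by
    rw [hu, hα, hβ, C_add, C_mul, sub_mul, mul_sub, mul_sub]
    rw [show (X * C a * (X * C b) : R[X]) = X ^ 2 * (C a * C b) by
      rw [mul_assoc, ← mul_assoc (C a), hX, mul_assoc, ← mul_assoc X X, sq]]
    rw [mul_add]
    simp only [one_mul, mul_one]
    abel
  have hdu : derivative u = C a * β + α * C b := by
    have h1 : u = 1 - α * β := by rw [← hαβ, sub_sub_cancel]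
    rw [h1, derivative_sub, derivative_mul, hα, hβ]
    simp only [derivative_sub, derivative_one, derivative_mul, derivative_X, derivative_C,
      one_mul, mul_zero, add_zero, zero_sub]
    noncomm_ring
  have e1 : EqBelow m (Ga * α) 1 := by
    rw [geomSum_X_mul_C_mul]; exact eqBelow_one_sub_X_pow_mul m _
  have e2 : EqBelow m (α * Ga) 1 := by
    rw [one_sub_mul_geomSum_X_mul_C]; exact eqBelow_one_sub_X_pow_mul m _
  have e3 : EqBelow m (β * Gb) 1 := by
    rw [one_sub_mul_geomSum_X_mul_C]; exact eqBelow_one_sub_X_pow_mul m _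
  have e4 : EqBelow m (S * (α * β)) 1 := by
    have h1 : u ^ m = X ^ m * (C (a + b) - X * C (a * b)) ^ m := by
      rw [← (show Commute (X : R[X]) _ from commute_X _).mul_pow, hu, mul_sub, sq, mul_assoc]
    rw [← hαβ, hS, geom_sum_mul_neg, h1]
    exact eqBelow_one_sub_X_pow_mul m _
  have hrefl : ∀ f : R[X], EqBelow m f f := fun f _ _ => rfl
  have e5 : EqBelow m S (Gb * Ga) := by
    have h1 : EqBelow m (S * (α * (β * Gb) * Ga)) S := by
      have h2 : EqBelow m (α * (β * Gb) * Ga) 1 :=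
        (((hrefl α).mul e3).mul (hrefl Ga)).trans (by rwa [mul_one])
      have h3 := (hrefl S).mul h2
      rwa [mul_one] at h3
    refine h1.symm.trans ?_
    have h2 : S * (α * (β * Gb) * Ga) = S * (α * β) * (Gb * Ga) := by noncomm_ring
    rw [h2]
    simpa using e4.mul (hrefl (Gb * Ga))
  rw [hdu, mul_add, coeff_add, map_add]
  congr 1
  · rw [← mul_assoc, map_coeff_mul_comm τ hτ, (((hrefl β).mul (e5.mul (hrefl (C a))))) n hn]
    rw [show β * (Gb * Ga * C a) = (β * Gb) * (Ga * C a) by noncomm_ring,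
      (e3.mul (hrefl (Ga * C a))) n hn, one_mul, coeff_geomSum_X_mul_C_mul_C a hn]
  · rw [(e5.mul (hrefl (α * C b))) n hn,
      show Gb * Ga * (α * C b) = Gb * ((Ga * α) * C b) by noncomm_ring,
      ((hrefl Gb).mul (e1.mul (hrefl (C b)))) n hn, one_mul, coeff_geomSum_X_mul_C_mul_C b hn]

variable [Algebra ℂ R]

/-- The value `X_k(a, b)` in an algebra. -/
noncomputable def polXEval (k : ℕ) (a b : R) : R :=
  ∑ j ∈ Finset.Icc 1 (k - 1), (j : ℂ)⁻¹ •
    ∑ S ∈ (Finset.univ : Finset (Finset (Fin j))) with k ≤ j + S.card,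
      ((-1 : ℂ) ^ S.card) • (List.ofFn fun m : Fin j => if m ∈ S then a * b else a + b).prod

theorem sum_inv_mul_trace_pow (τ : R →ₗ[ℂ] ℂ) (hτ : ∀ x y, τ (x * y) = τ (y * x)) (a b : R)
    (k : ℕ) :
    ∑ j ∈ Finset.Icc 1 (k - 1), (j : ℂ)⁻¹ * τ ((a + b - a * b) ^ j) =
      ∑ j ∈ Finset.Icc 1 (k - 1), (j : ℂ)⁻¹ * τ (a ^ j) +
        ∑ j ∈ Finset.Icc 1 (k - 1), (j : ℂ)⁻¹ * τ (b ^ j) + τ (polXEval k a b) := by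
  set u : R[X] := X * C (a + b) - X ^ 2 * C (a * b) with hu
  set y : ∀ j, Finset (Fin j) → R := fun j S =>
    (-1) ^ S.card * (List.ofFn fun m => if m ∈ S then a * b else a + b).prod with hy
  have hpow : ∀ j, (a + b - a * b) ^ j = ∑ S, y j S := fun j => by
    simpa using sub_pow_eq_sum_finset (fun x => Commute.one_left x) (a + b) (a * b) j
  have hcoeff : ∀ j d, (u ^ j).coeff d = ∑ S with j + S.card = d, y j S := fun j d => by
    rw [hu, sub_pow_eq_sum_finset (fun x => commute_X x), finsetSum_coeff, Finset.sum_filter]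
    refine Finset.sum_congr rfl fun S _ => ?_
    have hC : (List.ofFn fun m : Fin j => if m ∈ S then C (a * b) else C (a + b)).prod =
        C ((List.ofFn fun m : Fin j => if m ∈ S then a * b else a + b).prod) := by
      rw [map_list_prod, List.map_ofFn]
      congr 2
      funext m
      simp only [Function.comp_apply]
      split_ifs <;> rfl
    have hC2 : ((-1 : R[X]) ^ S.card) = C ((-1 : R) ^ S.card) := by simp
    rw [hC, hC2, ← C_mul, X_pow_mul_C, coeff_C_mul_X_pow]
    simp only [eq_comm, hy]
  have hX : τ (polXEval k a b) = ∑ j ∈ Finset.Icc 1 (k - 1), (j : ℂ)⁻¹ *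
      ∑ S ∈ (Finset.univ : Finset (Finset (Fin j))) with k ≤ j + S.card, τ (y j S) := by
    rw [polXEval, map_sum]
    refine Finset.sum_congr rfl fun j _ => ?_
    rw [map_smul, smul_eq_mul, map_sum]
    congr 1
    refine Finset.sum_congr rfl fun S _ => ?_
    congr 1
    simp only [hy]
    rcases neg_one_pow_eq_or ℂ S.card with h | h
    · have h' : (-1 : R) ^ S.card = 1 := by
        have := congrArg (algebraMap ℂ R) h
        simpa using this
      rw [h, h', one_smul, one_mul]
    · have h' : (-1 : R) ^ S.card = -1 := by
        have := congrArg (algebraMap ℂ R) h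
        simpa using this
      rw [h, h', neg_smul, one_smul, neg_one_mul]
  -- The terms left out of `X_k` are exactly those of degree below `k` in `u^j`.
  have hlow : ∀ j, ∑ S ∈ (Finset.univ : Finset (Finset (Fin j))) with ¬ k ≤ j + S.card,
      τ (y j S) = ∑ d ∈ Finset.range k, τ ((u ^ j).coeff d) := fun j => by
    simp only [hcoeff, map_sum]
    rw [← Finset.sum_fiberwise_of_maps_to (g := fun S : Finset (Fin j) => j + S.card)
      (t := Finset.range k) (by
        intro S hS
        simpa using hS)]
    refine Finset.sum_congr rfl fun d hd => Finset.sum_congr ?_ fun _ _ => rfl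
    ext S
    have := Finset.mem_range.1 hd
    simp only [Finset.mem_filter, Finset.mem_univ, true_and]
    omega
  -- Additivity of the logarithm under the trace. Multiplication by `d` passes to the coefficient of
  -- degree `n = d - 1` of the derivative.
  have hkey : ∀ d ∈ Finset.Icc 1 (k - 1),
      ∑ j ∈ Finset.Icc 1 (k - 1), (j : ℂ)⁻¹ * τ ((u ^ j).coeff d) =
        (d : ℂ)⁻¹ * τ (a ^ d) + (d : ℂ)⁻¹ * τ (b ^ d) := by
    intro d hd
    obtain ⟨hd1, hd2⟩ := Finset.mem_Icc.1 hd
    obtain ⟨n, rfl⟩ := Nat.exists_eq_add_of_le' hd1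
    have hn : n < k - 1 := by omega
    have h1 := map_coeff_geomSum_mul_derivative τ.toAddMonoidHom hτ a b hn hu
    simp only [LinearMap.toAddMonoidHom_coe] at h1
    have hne : ((n + 1 : ℕ) : ℂ) ≠ 0 := Nat.cast_ne_zero.2 (Nat.succ_ne_zero n)
    rw [← mul_add, ← h1, eq_inv_mul_iff_mul_eq₀ hne, Finset.sum_mul, finsetSum_coeff, map_sum,
      Finset.mul_sum, Finset.sum_Icc_one_eq_sum_range]
    refine Finset.sum_congr rfl fun i _ => ?_
    have h2 := map_coeff_derivative_pow τ.toAddMonoidHom hτ n u i 0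
    simp only [LinearMap.toAddMonoidHom_coe, pow_zero, mul_one, add_zero, coeff_derivative,
      nsmul_eq_mul] at h2
    have h3 : (u ^ (i + 1)).coeff (n + 1) * ((n : R) + 1) =
        ((n + 1 : ℕ) : ℂ) • (u ^ (i + 1)).coeff (n + 1) := by
      rw [Algebra.smul_def, map_natCast, Nat.cast_comm, Nat.cast_succ]
    rw [h3, map_smul, smul_eq_mul] at h2
    have hne' : ((i + 1 : ℕ) : ℂ) ≠ 0 := Nat.cast_ne_zero.2 (Nat.succ_ne_zero i)
    rw [mul_left_comm, h2, inv_mul_cancel_left₀ hne']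
  -- `u` has no constant term, so degree `0` adds nothing.
  have hzero : ∑ j ∈ Finset.Icc 1 (k - 1), (j : ℂ)⁻¹ * τ ((u ^ j).coeff 0) = 0 :=
    Finset.sum_eq_zero fun j hj => by
      have := (Finset.mem_Icc.1 hj).1
      rw [hcoeff, Finset.filter_false_of_mem (fun S _ => by omega), Finset.sum_empty, map_zero,
        mul_zero]
  calc ∑ j ∈ Finset.Icc 1 (k - 1), (j : ℂ)⁻¹ * τ ((a + b - a * b) ^ j)
      = ∑ j ∈ Finset.Icc 1 (k - 1), (j : ℂ)⁻¹ * ∑ d ∈ Finset.range k, τ ((u ^ j).coeff d) +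
          τ (polXEval k a b) := by
        rw [hX, ← Finset.sum_add_distrib]
        refine Finset.sum_congr rfl fun j _ => ?_
        rw [← mul_add, ← hlow, hpow, map_sum, add_comm, Finset.sum_filter_add_sum_filter_not]
    _ = ∑ d ∈ Finset.range k, ∑ j ∈ Finset.Icc 1 (k - 1), (j : ℂ)⁻¹ * τ ((u ^ j).coeff d) +
          τ (polXEval k a b) := by
        simp only [Finset.mul_sum]
        rw [Finset.sum_comm]
    _ = ∑ d ∈ Finset.Icc 1 (k - 1), ∑ j ∈ Finset.Icc 1 (k - 1),
          (j : ℂ)⁻¹ * τ ((u ^ j).coeff d) + τ (polXEval k a b) := by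
        congr 1
        refine (Finset.sum_subset (fun d hd => ?_) fun d hd hd' => ?_).symm
        · have := Finset.mem_Icc.1 hd
          exact Finset.mem_range.2 (by omega)
        · have h1 := Finset.mem_range.1 hd
          have : d = 0 := by
            by_contra h0
            exact hd' (Finset.mem_Icc.2 ⟨by omega, by omega⟩)
          rw [this, hzero]
    _ = _ := by
        rw [Finset.sum_congr rfl hkey, Finset.sum_add_distrib]

end TraceIdentity

/-! ### Words of `X_k` and their alternating exponent form. -/

section Words

/-- The monomial in the variables `A`, `B` spelled by a word; `false` stands for `A`. -/
def wordPol (w : List Bool) : Pol₂ := (w.map (FreeAlgebra.ι ℚ)).prod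

theorem wordPol_cons (c : Bool) (w : List Bool) :
    wordPol (c :: w) = FreeAlgebra.ι ℚ c * wordPol w := by
  simp [wordPol]

/-- The words occurring in the expansion of `∏_{c ∈ L} (if c then A * B else A + B)`. -/
def IsExpansionWord (L w : List Bool) : Prop :=
  w.length = L.length + L.count true ∧ (∀ c, w.count c ≤ L.length) ∧
    (w.length < 2 * L.length ∨ w = [] ∨ ∃ v, w = false :: v)

theorem mul_mem_span_of_forall {R : Type*} [Ring R] [Algebra ℚ R] {s t : Set R} (x : R)
    (h : ∀ y ∈ s, x * y ∈ Submodule.span ℚ t) {p : R} (hp : p ∈ Submodule.span ℚ s) :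
    x * p ∈ Submodule.span ℚ t := by
  induction hp using Submodule.span_induction with
  | mem y hy => exact h y hy
  | zero => simp
  | add y z _ _ hy hz => rw [mul_add]; exact add_mem hy hz
  | smul c y _ hy => rw [mul_smul_comm]; exact Submodule.smul_mem _ c hy

/-- If the leading factor is `AB`, the word starts with `A`; if it is `A + B`, the word falls short
of the maximal length. This accounts for the last clause of `IsExpansionWord`, which decides whether
the slots of the normal form suffice. -/
theorem list_prod_mem_span_wordPol (L : List Bool) :
    (L.map fun c => if c then varA * varB else varA + varB).prod ∈
      Submodule.span ℚ (wordPol '' {w | IsExpansionWord L w}) := by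
  induction L with
  | nil => exact Submodule.subset_span ⟨[], by simp [IsExpansionWord], by simp [wordPol]⟩
  | cons c L ih =>
    rw [List.map_cons, List.prod_cons]
    refine mul_mem_span_of_forall _ ?_ ih
    rintro _ ⟨w, ⟨h1, h2, -⟩, rfl⟩
    have hL : L.count true ≤ L.length := List.count_le_length
    cases c with
    | true =>
      refine Submodule.subset_span ⟨false :: true :: w, ⟨?_, ?_, Or.inr (Or.inr ⟨_, rfl⟩)⟩, ?_⟩
      · simp only [List.length_cons, List.count_cons_self]
        omega
      · intro c
        have := h2 c
        cases c <;> simp <;> omega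
      · simp [wordPol_cons, varA, varB, mul_assoc]
    | false =>
      simp only [Bool.false_eq_true, if_false, add_mul]
      have key : ∀ c, FreeAlgebra.ι ℚ c * wordPol w ∈
          Submodule.span ℚ (wordPol '' {w | IsExpansionWord (false :: L) w}) := fun c => by
        refine Submodule.subset_span ⟨c :: w, ⟨?_, ?_, Or.inl ?_⟩, wordPol_cons c w⟩
        · simp only [List.length_cons, List.count_cons]
          simp
          omega
        · intro d
          have := h2 d
          rw [List.count_cons, List.length_cons]
          split_ifs <;> omega
        · simp only [List.length_cons]
          omega
      exact add_mem (key false) (key true)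

/-- A word has length `j + |S| ≤ 2j`, and each of the `j ≤ k - 1` factors supplies either letter at
most once. -/
theorem polX_mem_span_wordPol (k : ℕ) :
    polX k ∈ Submodule.span ℚ (wordPol '' {w | k ≤ w.length ∧ w.length ≤ 2 * k - 2 ∧
      (∀ c, w.count c ≤ k - 1) ∧ (w.length < 2 * k - 2 ∨ w = [] ∨ ∃ v, w = false :: v)}) := by
  refine Submodule.sum_mem _ fun j hj => Submodule.smul_mem _ _ (Submodule.sum_mem _ fun S hS =>
    Submodule.smul_mem _ _ ?_)
  obtain ⟨hj1, hj2⟩ := Finset.mem_Icc.1 hj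
  have hS' : k ≤ j + S.card := (Finset.mem_filter.1 hS).2
  have hSj : S.card ≤ j := by simpa using S.card_le_univ
  have h := list_prod_mem_span_wordPol (List.ofFn fun m => decide (m ∈ S))
  have hy : yWord j S = ((List.ofFn fun m => decide (m ∈ S)).map
      fun c => if c then varA * varB else varA + varB).prod := by
    simp [yWord, List.map_ofFn, Function.comp_def]
  rw [hy]
  refine Submodule.span_mono (Set.image_mono ?_) h
  rintro w ⟨h1, h2, h3⟩
  rw [count_true_ofFn_mem, List.length_ofFn] at h1
  simp only [List.length_ofFn] at h2 h3
  refine ⟨by omega, by omega, fun c => (h2 c).trans hj2, ?_⟩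
  rcases h3 with h3 | h3
  · exact Or.inl (by omega)
  · exact Or.inr h3

/-- Slots alternate between the letters, starting with `b`. At most one slot per letter of the word
is needed, plus an empty slot in front if the word starts with the other letter; the disjunction
leaves room for it. -/
theorem exists_alternating_exponents (w : List Bool) : ∀ (n : ℕ) (b : Bool), w.length ≤ n →
    (w.length < n ∨ w = [] ∨ ∃ v, w = b :: v) →
    ∃ e : Fin n → ℕ, (∀ l : Fin n, e l ≤ w.count (b ^^ (l : ℕ).bodd)) ∧ ∑ l, e l = w.length ∧
      wordPol w = (List.ofFn fun l : Fin n =>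
        FreeAlgebra.ι ℚ (b ^^ (l : ℕ).bodd) ^ e l).prod := by
  induction w with
  | nil =>
    intro n b _ _
    exact ⟨fun _ => 0, fun _ => Nat.zero_le _, by simp, by simp [wordPol]⟩
  | cons c w ih =>
    have hsame : ∀ n, w.length + 1 ≤ n → ∃ e : Fin n → ℕ,
        (∀ l : Fin n, e l ≤ (c :: w).count (c ^^ (l : ℕ).bodd)) ∧
        ∑ l, e l = (c :: w).length ∧ wordPol (c :: w) = (List.ofFn fun l : Fin n =>
          FreeAlgebra.ι ℚ (c ^^ (l : ℕ).bodd) ^ e l).prod := by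
      intro n hn
      obtain ⟨m, rfl⟩ := Nat.exists_eq_add_of_le' (Nat.one_le_of_lt hn)
      -- The remaining word is shorter than the number of slots, so its expansion may be started at
      -- the letter `c`, whose slot then absorbs the leading `c`.
      obtain ⟨e, he1, he2, he3⟩ := ih (m + 1) c (by omega) (Or.inl (by omega))
      refine ⟨Fin.cons (e 0 + 1) fun i => e i.succ, ?_, ?_, ?_⟩
      · intro l
        refine Fin.cases ?_ (fun l => ?_) l
        · simpa using he1 0
        · exact (he1 l.succ).trans List.count_le_count_cons
      · rw [Fin.sum_univ_succ] at he2 ⊢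
        simp only [Fin.cons_zero, Fin.cons_succ, List.length_cons]
        omega
      · rw [wordPol_cons, he3, List.ofFn_succ, List.ofFn_succ, List.prod_cons, List.prod_cons]
        simp [pow_succ', mul_assoc]
    intro n b hn h
    rcases eq_or_ne c b with rfl | hcb
    · exact hsame n (by simpa using hn)
    · have hlt : (c :: w).length < n := by
        rcases h with h | h | ⟨v, h⟩
        · exact h
        · simp at h
        · simp only [List.cons.injEq] at h
          exact absurd h.1 hcb
      obtain ⟨m, rfl⟩ := Nat.exists_eq_add_of_le' (Nat.one_le_of_lt hlt)
      obtain ⟨e, he1, he2, he3⟩ := hsame m (by simpa using hlt)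
      have hc : c = !b := by
        cases c <;> cases b <;> simp at hcb ⊢
      refine ⟨Fin.cons 0 e, ?_, ?_, ?_⟩
      · intro l
        refine Fin.cases (Nat.zero_le _) (fun l => ?_) l
        simpa [hc] using he1 l
      · rw [Fin.sum_univ_succ]
        simpa using he2
      · rw [List.ofFn_succ, List.prod_cons, he3]
        simp [hc]

end Words

/-! ### Evaluation at operators and continuity of `X_k` from `B_k` to the trace class. -/

section Evaluation

variable {H : Type u} [NormedAddCommGroup H] [InnerProductSpace ℂ H] (A B : H →L[ℂ] H)

theorem evalPol_zero : evalPol A B 0 = 0 := by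
  unfold evalPol; exact map_zero _

theorem evalPol_one : evalPol A B 1 = 1 := by
  unfold evalPol; exact map_one _

theorem evalPol_add (p q : Pol₂) : evalPol A B (p + q) = evalPol A B p + evalPol A B q := by
  unfold evalPol; exact map_add _ p q

theorem evalPol_mul (p q : Pol₂) : evalPol A B (p * q) = evalPol A B p * evalPol A B q := by
  unfold evalPol; exact map_mul _ p q

theorem evalPol_smul (c : ℚ) (p : Pol₂) : evalPol A B (c • p) = (c : ℂ) • evalPol A B p := by
  let _ : Algebra ℚ (H →L[ℂ] H) := Algebra.compHom (H →L[ℂ] H) (algebraMap ℚ ℂ)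
  unfold evalPol; exact map_smul (FreeAlgebra.lift ℚ fun b : Bool => if b then B else A) c p

theorem evalPol_ι (c : Bool) : evalPol A B (FreeAlgebra.ι ℚ c) = if c then B else A := by
  let _ : Algebra ℚ (H →L[ℂ] H) := Algebra.compHom (H →L[ℂ] H) (algebraMap ℚ ℂ)
  unfold evalPol; exact FreeAlgebra.lift_ι_apply (R := ℚ) (fun b : Bool => if b then B else A) c

theorem evalPol_list_prod (L : List Pol₂) :
    evalPol A B L.prod = (L.map (evalPol A B)).prod := by
  induction L with
  | nil => simpa using evalPol_one A B
  | cons p L ih => rw [List.prod_cons, evalPol_mul, ih, List.map_cons, List.prod_cons]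

theorem evalPol_sum {ι : Type*} (s : Finset ι) (f : ι → Pol₂) :
    evalPol A B (∑ i ∈ s, f i) = ∑ i ∈ s, evalPol A B (f i) := by
  classical
  induction s using Finset.induction_on with
  | empty => simpa using evalPol_zero A B
  | insert i s hi ih => rw [Finset.sum_insert hi, Finset.sum_insert hi, evalPol_add, ih]

theorem evalPol_wordPol (w : List Bool) :
    evalPol A B (wordPol w) = (w.map fun c => if c then B else A).prod := by
  rw [wordPol, evalPol_list_prod, List.map_map]
  congr 2
  funext c
  exact evalPol_ι A B c

theorem evalPol_polX (k : ℕ) : evalPol A B (polX k) = polXEval k A B := by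
  have hA : evalPol A B varA = A := (evalPol_ι A B false).trans (by simp)
  have hB : evalPol A B varB = B := (evalPol_ι A B true).trans (by simp)
  simp only [polX, polXEval, evalPol_sum, evalPol_smul, yWord, evalPol_list_prod, List.map_ofFn]
  refine Finset.sum_congr rfl fun j _ => ?_
  push_cast
  congr 1
  refine Finset.sum_congr rfl fun S _ => ?_
  congr 3
  funext m
  simp only [Function.comp_apply]
  split_ifs
  · rw [evalPol_mul, hA, hB]
  · rw [evalPol_add, hA, hB]

variable {α : Type*} {l : Filter α}

theorem SchattenTendsto.evalPol_wordPol {k : ℕ} (hk : 1 ≤ k) {S T : α → H →L[ℂ] H}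
    {A B : H →L[ℂ] H} (hS : SchattenTendsto k l S A) (hT : SchattenTendsto k l T B)
    {w : List Bool} (hw : k ≤ w.length) :
    SchattenTendsto 1 l (fun s => evalPol (S s) (T s) (wordPol w)) (evalPol A B (wordPol w)) := by
  simp only [_root_.evalPol_wordPol]
  have hW : ∀ c : Bool, SchattenTendsto k l (fun s => if c then T s else S s)
      (if c then B else A) := fun c => by
    cases c with
    | false => simpa only [Bool.false_eq_true, if_false] using hS
    | true => simpa only [if_true] using hT
  have hlist : ∀ (W : Bool → α → H →L[ℂ] H) (W₀ : Bool → H →L[ℂ] H),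
      (∀ c, SchattenTendsto k l (W c) (W₀ c)) →
      SchattenTendsto 1 l (fun s => (w.map (W · s)).prod) ((w.map W₀).prod) :=
    fun W W₀ hW => SchattenTendsto.list_prod_of_le_length hk hW w hw
  exact hlist _ _ hW

theorem SchattenTendsto.zero {p : ℝ} (hp : 0 < p) :
    SchattenTendsto p l (fun _ => (0 : H →L[ℂ] H)) 0 := by
  have h0 : schattenSum p (0 : H →L[ℂ] H) = 0 := by
    have := schattenSum_smul_le 0 (0 : H →L[ℂ] H) hp.le
    rw [smul_zero, enorm_zero, ENNReal.zero_rpow_of_pos hp, zero_mul] at this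
    exact le_antisymm this zero_le
  refine ⟨by rw [h0]; exact ENNReal.zero_ne_top, ?_⟩
  simp only [sub_zero, h0]
  exact tendsto_const_nhds

theorem SchattenTendsto.polXEval {k : ℕ} (hk : 1 ≤ k) {S T : α → H →L[ℂ] H}
    {A B : H →L[ℂ] H} (hS : SchattenTendsto k l S A) (hT : SchattenTendsto k l T B) :
    SchattenTendsto 1 l (fun s => polXEval k (S s) (T s)) (polXEval k A B) := by
  simp only [← evalPol_polX]
  refine Submodule.span_induction
    (p := fun p _ => SchattenTendsto 1 l (fun s => evalPol (S s) (T s) p) (evalPol A B p))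
    ?_ ?_ ?_ ?_ (polX_mem_span_wordPol k)
  · rintro _ ⟨w, hw, rfl⟩
    exact hS.evalPol_wordPol hk hT hw.1
  · simp only [evalPol_zero]
    exact SchattenTendsto.zero one_pos
  · intro p q _ _ hp hq
    simp only [evalPol_add]
    exact hp.add one_pos hq
  · intro c p _ hp
    simp only [evalPol_smul]
    exact hp.smul one_pos _

end Evaluation

theorem polX_one : polX 1 = 0 := by simp [polX]

theorem exists_exponent_form_of_mem_span {k : ℕ} (hk : 2 ≤ k) {p : Pol₂}
    (hp : p ∈ Submodule.span ℚ (wordPol '' {w | k ≤ w.length ∧ w.length ≤ 2 * k - 2 ∧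
      (∀ c, w.count c ≤ k - 1) ∧ (w.length < 2 * k - 2 ∨ w = [] ∨ ∃ v, w = false :: v)})) :
    ∃ c : (Fin (2 * k - 2) → Fin k) → ℚ,
      (∀ j, c j ≠ 0 → k ≤ ∑ l, (j l : ℕ) ∧ ∑ l, (j l : ℕ) ≤ 2 * k - 2) ∧
      p = ∑ j, c j • (List.ofFn fun l : Fin (2 * k - 2) =>
        FreeAlgebra.ι ℚ (false ^^ (l : ℕ).bodd) ^ (j l : ℕ)).prod := by
  induction hp using Submodule.span_induction with
  | mem p hp =>
    obtain ⟨w, ⟨h1, h2, h3, h4⟩, rfl⟩ := hp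
    obtain ⟨e, he1, he2, he3⟩ := exists_alternating_exponents w (2 * k - 2) false h2 h4
    -- An exponent is at most the number of occurrences of its letter, hence at most `k - 1`.
    have hlt : ∀ l, e l < k := fun l =>
      ((he1 l).trans (h3 _)).trans_lt (by omega)
    refine ⟨Pi.single (fun l => ⟨e l, hlt l⟩) 1, fun j hj => ?_, ?_⟩
    · have hje : j = fun l => ⟨e l, hlt l⟩ := by
        by_contra hne
        exact hj (Pi.single_eq_of_ne hne _)
      subst hje
      simp only [he2]
      exact ⟨h1, h2⟩
    · rw [he3, Finset.sum_eq_single_of_mem (fun l => ⟨e l, hlt l⟩) (Finset.mem_univ _)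
        fun j _ hj => by rw [Pi.single_eq_of_ne hj, zero_smul]]
      rw [Pi.single_eq_same, one_smul]
  | zero => exact ⟨0, by simp, by simp⟩
  | add p q _ _ hp hq =>
    obtain ⟨c, hc, rfl⟩ := hp
    obtain ⟨d, hd, rfl⟩ := hq
    refine ⟨c + d, fun j hj => ?_, ?_⟩
    · by_cases h : c j = 0
      · refine hd j fun h' => hj ?_
        rw [Pi.add_apply, h, h', add_zero]
      · exact hc j h
    · simp only [Pi.add_apply, add_smul, Finset.sum_add_distrib]
  | smul r p _ hp =>
    obtain ⟨c, hc, rfl⟩ := hp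
    refine ⟨r • c, fun j hj => hc j fun h => hj ?_, ?_⟩
    · rw [Pi.smul_apply, h, smul_zero]
    · simp only [Pi.smul_apply, smul_assoc, Finset.smul_sum]

/-! ### Compressed operators: convergence and the exact identity. -/

section Compressions

variable {H : Type u} [NormedAddCommGroup H] [InnerProductSpace ℂ H]

theorem tendsto_innerSL_smulRight {α : Type*} {l : Filter α} {f g : α → H} {v u : H}
    (hf : Tendsto f l (𝓝 v)) (hg : Tendsto g l (𝓝 u)) :
    Tendsto (fun s => (innerSL ℂ (f s)).smulRight (g s)) l (𝓝 ((innerSL ℂ v).smulRight u)) := by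
  have h1 : Tendsto (fun s => ContinuousLinearMap.smulRightL ℂ H H (innerSL ℂ (f s))) l
      (𝓝 (ContinuousLinearMap.smulRightL ℂ H H (innerSL ℂ v))) :=
    ((ContinuousLinearMap.smulRightL ℂ H H).continuous.tendsto _).comp
      (((innerSL ℂ).continuous.tendsto v).comp hf)
  exact ((isBoundedBilinearMap_apply (𝕜 := ℂ) (E := H) (F := H →L[ℂ] H)).continuous.tendsto
    (_, u)).comp (h1.prodMk_nhds hg)

variable {ι : Type u} (b : HilbertBasis ι ℂ H) (s : Finset ι)

theorem rank_basisProj_mul_mul_sub_le {n : ℕ} {F : H →L[ℂ] H}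
    (hF : (F : H →ₗ[ℂ] H).rank ≤ (n : Cardinal.{u})) :
    ((basisProj b s * F * basisProj b s - F : H →L[ℂ] H) : H →ₗ[ℂ] H).rank ≤
      ((n + n : ℕ) : Cardinal.{u}) := by
  rw [sub_eq_add_neg, ContinuousLinearMap.toLinearMap_add, Nat.cast_add]
  refine (LinearMap.rank_add_le _ _).trans (add_le_add ?_ ?_)
  · refine (LinearMap.rank_comp_le_left (basisProj b s : H →ₗ[ℂ] H)
      ((basisProj b s * F : H →L[ℂ] H) : H →ₗ[ℂ] H)).trans ?_
    exact (LinearMap.rank_comp_le_right (F : H →ₗ[ℂ] H) (basisProj b s : H →ₗ[ℂ] H)).trans hF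
  · exact (LinearMap.rank_comp_le_right (F : H →ₗ[ℂ] H) (-LinearMap.id)).trans hF

theorem commute_basisProj_mul_mul (A : H →L[ℂ] H) :
    Commute (basisProj b s) (basisProj b s * A * basisProj b s) := by
  have h := basisProj_mul_self b s
  rw [commute_iff_eq, ← mul_assoc, ← mul_assoc, h, mul_assoc (basisProj b s * A), h]

open Classical in
theorem compress_polXEval (k : ℕ) {A B : H →L[ℂ] H} (hA : Commute (basisProj b s) A)
    (hB : Commute (basisProj b s) B) :
    compress b s (polXEval k A B) = polXEval k (compress b s A) (compress b s B) := by
  simp only [polXEval, map_sum, map_smul]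
  refine Finset.sum_congr rfl fun j _ => ?_
  congr 1
  refine Finset.sum_congr rfl fun S _ => ?_
  rw [compress_list_prod]
  · rw [List.map_ofFn]
    congr 3
    funext m
    simp only [Function.comp_apply]
    split_ifs
    · exact compress_mul b s hB
    · exact map_add _ _ _
  · intro T hT
    obtain ⟨m, rfl⟩ := (List.mem_ofFn' _ _).1 hT
    dsimp only
    split_ifs
    · exact hA.mul_right hB
    · exact hA.add_right hB

end Compressions

section CompressionLimits

variable {H : Type u} [NormedAddCommGroup H] [InnerProductSpace ℂ H] [CompleteSpace H]
  {ι : Type u} (b : HilbertBasis ι ℂ H)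

/-- Compressing a rank one operator projects its two vectors, and the projections converge strongly
to the identity. -/
theorem tendsto_basisProj_mul_mul_of_rank_le {n : ℕ} {F : H →L[ℂ] H}
    (hF : (F : H →ₗ[ℂ] H).rank ≤ (n : Cardinal.{u})) :
    Tendsto (fun s => basisProj b s * F * basisProj b s) atTop (𝓝 F) := by
  obtain ⟨r, -, u, v, -, -, h⟩ := exists_sum_inner_smul_of_rank_le hF
  have hF' : F = ∑ j, (innerSL ℂ (v j)).smulRight (u j) := by
    ext x
    rw [h, _root_.sum_apply]
    rfl
  have hP : ∀ s, basisProj b s * F * basisProj b s =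
      ∑ j, (innerSL ℂ (basisProj b s (v j))).smulRight (basisProj b s (u j)) := fun s => by
    ext x
    rw [mul_apply_eq_comp, mul_apply_eq_comp, h, map_sum, _root_.sum_apply]
    refine Finset.sum_congr rfl fun j _ => ?_
    rw [map_smul, ← inner_basisProj_left]
    rfl
  have hlim : ∀ j, Tendsto (fun s => (innerSL ℂ (basisProj b s (v j))).smulRight
      (basisProj b s (u j))) atTop (𝓝 ((innerSL ℂ (v j)).smulRight (u j))) := fun j =>
    tendsto_innerSL_smulRight (tendsto_basisProj b (v j)) (tendsto_basisProj b (u j))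
  have hsum := tendsto_finsetSum Finset.univ fun j _ => hlim j
  rw [← hF'] at hsum
  exact hsum.congr fun s => (hP s).symm

/-- Split `PAP - A = (PFP - F) + P(A - F)P - (A - F)` with `F` of finite rank close to `A`. The
first term has rank at most `2n` and norm tending to `0`; the others are small uniformly in `P`. The
constant `K = 2C²` collects two uses of the quasi-triangle inequality. -/
theorem schattenTendsto_basisProj_mul_mul {p : ℝ} (hp : 0 < p) {A : H →L[ℂ] H}
    (hA : schattenSum p A ≠ ∞) :
    SchattenTendsto p atTop (fun s => basisProj b s * A * basisProj b s) A := by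
  refine ⟨hA, ENNReal.tendsto_nhds_zero.2 fun ε hε => ?_⟩
  set C : ℝ≥0∞ := 2 * 2 ^ p with hC
  have hCtop : C ≠ ∞ := ENNReal.mul_ne_top (by simp)
    (ENNReal.rpow_ne_top_of_nonneg hp.le (by simp))
  have hC0 : C ≠ 0 := mul_ne_zero (by simp) (ENNReal.rpow_pos (by simp) (by simp)).ne'
  set K : ℝ≥0∞ := C * (C * 2) with hK
  have hKtop : K ≠ ∞ := by finiteness
  have hK0 : K ≠ 0 := mul_ne_zero hC0 (mul_ne_zero hC0 (by simp))
  have hε2 : ε / 2 ≠ 0 := (ENNReal.half_pos hε.ne').ne'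
  obtain ⟨n, F, hF, hAF⟩ := exists_rank_le_schattenSum_sub_le hp hA
    (ENNReal.div_ne_zero.2 ⟨hε2, hKtop⟩)
  have hlim : Tendsto (fun s => C * ((n + n : ℕ) *
      ‖basisProj b s * F * basisProj b s - F‖ₑ ^ p)) atTop (𝓝 0) := by
    have h1 : Tendsto (fun s => ‖basisProj b s * F * basisProj b s - F‖ₑ) atTop (𝓝 0) := by
      simpa [edist_eq_enorm_sub] using
        tendsto_iff_edist_tendsto_0.1 (tendsto_basisProj_mul_mul_of_rank_le b hF)
    have h2 := ((ENNReal.continuous_rpow_const (y := p)).tendsto 0).comp h1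
    rw [ENNReal.zero_rpow_of_pos hp] at h2
    have h3 := ENNReal.Tendsto.const_mul (a := C) (ENNReal.Tendsto.const_mul
      (a := ((n + n : ℕ) : ℝ≥0∞)) h2 (Or.inr (ENNReal.natCast_ne_top _))) (Or.inr hCtop)
    simpa using h3
  filter_upwards [hlim.eventually_le_const (pos_iff_ne_zero.2 hε2)] with s hs
  set P := basisProj b s with hP
  have hP1 : ‖P‖ₑ ^ p ≤ 1 := by
    refine ENNReal.rpow_le_one ?_ hp.le
    rw [← ofReal_norm, ← ENNReal.ofReal_one]
    exact ENNReal.ofReal_le_ofReal (norm_basisProj_le b s)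
  have hE : schattenSum p (P * (A - F) * P) ≤ schattenSum p (A - F) :=
    calc _ ≤ schattenSum p (P * (A - F)) * ‖P‖ₑ ^ p := schattenSum_mul_le_right _ _ hp.le
      _ ≤ ‖P‖ₑ ^ p * schattenSum p (A - F) * ‖P‖ₑ ^ p := by
        gcongr
        exact schattenSum_mul_le_left _ _ hp.le
      _ ≤ 1 * schattenSum p (A - F) * 1 := by gcongr
      _ = _ := by rw [one_mul, mul_one]
  have hsplit : P * A * P - A = (P * F * P - F) + (P * (A - F) * P + -(A - F)) := by
    noncomm_ring
  rw [hsplit]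
  calc _ ≤ C * (schattenSum p (P * F * P - F) + C * (schattenSum p (P * (A - F) * P) +
        schattenSum p (-(A - F)))) := by
        refine (schattenSum_add_le _ _ hp.le).trans ?_
        gcongr
        exact schattenSum_add_le _ _ hp.le
    _ ≤ C * ((n + n : ℕ) * ‖P * F * P - F‖ₑ ^ p + C * (schattenSum p (A - F) +
        schattenSum p (A - F))) := by
        gcongr
        · exact schattenSum_le_of_rank_le hp (rank_basisProj_mul_mul_sub_le b s hF)
        · exact schattenSum_neg_le _ hp.le
    _ = C * ((n + n : ℕ) * ‖P * F * P - F‖ₑ ^ p) + K * schattenSum p (A - F) := by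
        rw [hK]; ring
    _ ≤ ε / 2 + K * (ε / 2 / K) := by gcongr
    _ = ε := by rw [ENNReal.mul_div_cancel hK0 hKtop, ENNReal.add_halves]

variable (s : Finset ι)

open Classical in
-- The signs in `regR` cancel those of `(-T)^j`. As `T` commutes with the projection, compression
-- carries the operator exponential to a matrix exponential, whose determinant is the exponential of
-- a trace.
theorem sectionDet_regR_neg (k : ℕ) {T : H →L[ℂ] H} (hT : Commute (basisProj b s) T) :
    sectionDet b (regR k (-T)) s = (1 - compress b s T).det *
      Complex.exp (∑ j ∈ Finset.Icc 1 (k - 1), (j : ℂ)⁻¹ * (compress b s T ^ j).trace) := by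
  set E := ∑ j ∈ Finset.Icc 1 (k - 1), ((-1 : ℂ) ^ j * (j : ℂ)⁻¹) • (-T) ^ j with hE
  have hEeq : E = ∑ j ∈ Finset.Icc 1 (k - 1), (j : ℂ)⁻¹ • T ^ j := by
    refine Finset.sum_congr rfl fun j _ => ?_
    rw [neg_pow T j, ← neg_one_smul ℂ (1 : H →L[ℂ] H), smul_pow, one_pow, smul_mul_assoc, one_mul,
      smul_smul, mul_right_comm, ← mul_pow, neg_mul_neg, one_mul, one_pow, one_mul]
  have hcE : Commute (basisProj b s) E := by
    rw [hEeq]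
    exact Commute.sum_right _ _ _ fun j _ => (hT.pow_right j).smul_right _
  have hcexp : Commute (basisProj b s) (NormedSpace.exp E) := by
    let _ : NormedAlgebra ℚ (H →L[ℂ] H) := NormedAlgebra.restrictScalars ℚ ℂ _
    exact hcE.exp_right
  have hcompE : compress b s E =
      ∑ j ∈ Finset.Icc 1 (k - 1), (j : ℂ)⁻¹ • compress b s T ^ j := by
    rw [hEeq, map_sum]
    exact Finset.sum_congr rfl fun j _ => by rw [map_smul, compress_pow b s hT]
  have h1 : 1 + regR k (-T) = (1 - T) * NormedSpace.exp E := by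
    rw [regR, ← hE, add_sub_cancel, sub_eq_add_neg]
  rw [sectionDet_eq, h1, compress_mul b s hcexp, compress_exp b s hcE, map_sub, compress_one,
    Matrix.det_mul, Matrix.det_exp_eq_exp_trace, hcompE, Matrix.trace_sum]
  simp only [Matrix.trace_smul, smul_eq_mul]

theorem sectionDet_regR_product (k : ℕ) {A B : H →L[ℂ] H} (hA : Commute (basisProj b s) A)
    (hB : Commute (basisProj b s) B) :
    sectionDet b (regR k (-(A + B - A * B))) s =
      sectionDet b (regR k (-A)) s * sectionDet b (regR k (-B)) s *
        Complex.exp (∑ i ∈ s, inner ℂ (b i) (polXEval k A B (b i))) := by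
  classical
  have hC : Commute (basisProj b s) (A + B - A * B) :=
    (hA.add_right hB).sub_right (hA.mul_right hB)
  rw [sectionDet_regR_neg b s k hA, sectionDet_regR_neg b s k hB, sectionDet_regR_neg b s k hC,
    ← trace_compress, compress_polXEval b s k hA hB, map_sub, map_add, compress_mul b s hB]
  set a := compress b s A
  set c := compress b s B
  have hdet : (1 - (a + c - a * c)).det = (1 - a).det * (1 - c).det := by
    rw [← Matrix.det_mul]
    congr 1
    noncomm_ring
  have htr := sum_inv_mul_trace_pow (Matrix.traceLinearMap s ℂ ℂ)
    (fun x y => Matrix.trace_mul_comm x y) a c k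
  simp only [Matrix.traceLinearMap_apply] at htr
  rw [htr, hdet, Complex.exp_add, Complex.exp_add]
  ring

end CompressionLimits

/-! ### Uniqueness of values, and the theorem. -/

section Existence

variable {H : Type u} [NormedAddCommGroup H] [InnerProductSpace ℂ H] [CompleteSpace H]

/-- A Hilbert basis exists, so the quantification over bases is not vacuous and the value is unique.
-/
theorem HasTrace.opTrace_eq {T : H →L[ℂ] H} {t : ℂ} (h : HasTrace T t) : opTrace T = t := by
  have hex : ∃ t, HasTrace T t := ⟨t, h⟩
  obtain ⟨w, b, -⟩ := exists_hilbertBasis ℂ H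
  rw [opTrace, dif_pos hex]
  exact (hex.choose_spec _ b).unique (h _ b)

theorem HasRegDet.regDet_eq {p : ℕ} {S : H →L[ℂ] H} {d : ℂ} (h : HasRegDet p S d) :
    regDet p S = d := by
  have hex : ∃ d, HasRegDet p S d := ⟨d, h⟩
  obtain ⟨w, b, -⟩ := exists_hilbertBasis ℂ H
  rw [regDet, dif_pos hex]
  exact tendsto_nhds_unique (hex.choose_spec.2 _ b) (h.2 _ b)

end Existence

theorem mainTheorem12 {H : Type*} [NormedAddCommGroup H] [InnerProductSpace ℂ H]
    [CompleteSpace H] [TopologicalSpace.SeparableSpace H] (k : ℕ) (hk : 1 ≤ k) :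
    (k = 1 → polX k = 0) ∧
    (2 ≤ k →
      ∃ (C : Fin (2 * k - 2) → Pol₂) (c : (Fin (2 * k - 2) → Fin k) → ℚ),
        (∀ l, C l = varA ∨ C l = varB) ∧
        (∀ j, c j ≠ 0 → k ≤ ∑ l, (j l : ℕ) ∧ ∑ l, (j l : ℕ) ≤ 2 * k - 2) ∧
        polX k = ∑ j, c j • (List.ofFn fun l => C l ^ (j l : ℕ)).prod) ∧
    ∀ A B : H →L[ℂ] H, IsSchatten k A → IsSchatten k B →
      IsSchatten 1 (evalPol A B (polX k)) ∧
      HasTrace (evalPol A B (polX k)) (opTrace (evalPol A B (polX k))) ∧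
      HasRegDet k (1 - A) (regDet k (1 - A)) ∧
      HasRegDet k (1 - B) (regDet k (1 - B)) ∧
      HasRegDet k ((1 - A) * (1 - B)) (regDet k ((1 - A) * (1 - B))) ∧
      regDet k ((1 - A) * (1 - B)) =
        regDet k (1 - A) * regDet k (1 - B) *
          Complex.exp (opTrace (evalPol A B (polX k))) := by
  refine ⟨?_, fun hk2 => ?_, fun A B hA hB => ?_⟩
  · rintro rfl
    exact polX_one
  · obtain ⟨c, hc, h⟩ := exists_exponent_form_of_mem_span hk2 (polX_mem_span_wordPol k)
    refine ⟨fun l => FreeAlgebra.ι ℚ (false ^^ (l : ℕ).bodd), c, fun l => ?_, hc, h⟩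
    cases hl : (l : ℕ).bodd
    exacts [Or.inl (by simp [hl, varA]), Or.inr (by simp [hl, varB])]
  · have hk0 : (0 : ℝ) < k := by exact_mod_cast hk
    obtain ⟨w, b, -⟩ := exists_hilbertBasis ℂ H
    rw [isSchatten_iff] at hA hB
    have hAs := schattenTendsto_basisProj_mul_mul b hk0 hA
    have hBs := schattenTendsto_basisProj_mul_mul b hk0 hB
    -- The product is formed after compressing the factors, instead of compressing `A + B - AB`.
    -- This keeps the finite section identity exact for each `s`, and the limit is still `A + B -
    -- AB`.
    have hCs := (hAs.add hk0 hBs).add hk0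
      ((hAs.mul_of_tendsto hk0 (hBs.tendsto hk0)).neg hk0)
    simp only [← sub_eq_add_neg] at hCs
    have hX := hAs.polXEval hk hBs
    have hRA := (hAs.neg hk0).regR hk
    have hRB := (hBs.neg hk0).regR hk
    have hRC := (hCs.neg hk0).regR hk
    obtain ⟨t, ht⟩ := exists_hasTrace hX.1
    obtain ⟨dA, hdA⟩ := exists_hasFredholmDet hRA.1
    obtain ⟨dB, hdB⟩ := exists_hasFredholmDet hRB.1
    obtain ⟨dC, hdC⟩ := exists_hasFredholmDet hRC.1
    have hlim := hRC.tendsto_sectionDet hdC b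
    have hprod : dC = dA * dB * Complex.exp t := by
      refine tendsto_nhds_unique hlim (Tendsto.congr (fun s => ?_)
        (((hRA.tendsto_sectionDet hdA b).mul (hRB.tendsto_sectionDet hdB b)).mul
          ((Complex.continuous_exp.tendsto t).comp (hX.tendsto_sum_inner ht b))))
      exact (sectionDet_regR_product b s k (commute_basisProj_mul_mul b s A)
        (commute_basisProj_mul_mul b s B)).symm
    have eA : 1 - A - 1 = -A := by abel
    have eB : 1 - B - 1 = -B := by abel
    have eC : (1 - A) * (1 - B) - 1 = -(A + B - A * B) := by noncomm_ring
    have rA : HasRegDet k (1 - A) dA := ⟨by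
      rw [eA, isSchatten_iff]; exact (hAs.neg hk0).1, by rwa [eA]⟩
    have rB : HasRegDet k (1 - B) dB := ⟨by
      rw [eB, isSchatten_iff]; exact (hBs.neg hk0).1, by rwa [eB]⟩
    have rC : HasRegDet k ((1 - A) * (1 - B)) dC := ⟨by
      rw [eC, isSchatten_iff]; exact (hCs.neg hk0).1, by rwa [eC]⟩
    rw [evalPol_polX, rA.regDet_eq, rB.regDet_eq, rC.regDet_eq, ht.opTrace_eq]
    refine ⟨?_, ht, rA, rB, rC, hprod⟩
    rw [isSchatten_iff, Nat.cast_one]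
    exact hX.1
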